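/- All Hilbert spaces are finite-dimensional, $\log$ is to base $2$, and for $R\ge 0$ the message set $[2^{R}]$ is $\{1,\dots,\lfloor 2^{R}\rfloor\}$. For states $\rho,\sigma$ and $\varepsilon\in(0,1)$ let $$D_H^{\varepsilon}(\rho\|\sigma)=\sup_{0\preceq\Lambda\preceq I,\ \mathrm{Tr}(\Lambda\rho)\ge 1-\varepsilon}\log\frac{1}{\mathrm{Tr}(\Lambda\sigma)}.$$ Let $\mathcal N_{AB\to C}$ be a quantum channel (a completely positive trace-preserving map). An $(R_1,R_2,e_1,e_2)$-entanglement assisted code for the multiple access channel $\mathcal N_{AB\to C}$ consists of a pure state $|\theta\rangle_{E_AE_{C_1}}$ shared by Alice and Charlie, a pure state $|\theta\rangle_{E_BE_{C_2}}$ shared by Bob and Charlie, encoding channels $\mathcal E_1:M_1E_A\to A$ and $\mathcal E_2:M_2E_B\to B$ of Alice and Bob, and a decoding channel $\mathcal D:E_{C_1}E_{C_2}C\to M_1'M_2'$ of Charlie, such that for every pair of messages $(m_1,m_2)\in[2^{R_1}]\times[2^{R_2}]$ that is sent, the decoded pair $(M_1',M_2')$ satisfies $\Pr(M_1'\ne m_1)\le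 e_1$ and $\Pr(M_2'\ne m_2)\le e_2$. **Theorem.** Fix a quantum channel $\mathcal N_{AB\to C}$, $\varepsilon_1,\varepsilon_2,\delta\in(0,1)$ with $\delta\le\min\{\varepsilon_1,\varepsilon_2\}$, and a quantum state $\psi_{ABA'B'A''B''}$ satisfying $\psi_{ABA'B'A''B''}=\psi_{AA'A''}\otimes\psi_{BB'B''}$ and $\psi_{A'B'A''B''}=\psi_{A'}\otimes\psi_{A''}\otimes\psi_{B'}\otimes\psi_{B''}$, and put $\rho_{CA'B'A''B''}=\mathcal N_{AB\to C}(\psi_{ABA'B'A''B''})$. If $R_1,R_2\ge 0$ satisfy $$R_1\le D_H^{\varepsilon_1}(\rho_{A'CA''B''}\,\|\,\rho_{CA''B''}\otimes\rho_{A'})-\log\frac{4\varepsilon_1}{\delta^2},\qquad R_2\le D_H^{\varepsilon_2}(\rho_{B'CA''B''}\,\|\,\rho_{CA''B''}\otimes\rho_{B'})-\log\frac{4\varepsilon_2}{\delta^2},$$ then there exist an $(R_1,R_2,\ \varepsilon_1+2\delta,\ \varepsilon_2+2\delta+3\sqrt{\varepsilon_1+2\delta})$-entanglement assisted code and an $(R_1,R_2,\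 \varepsilon_1+2\delta+3\sqrt{\varepsilon_2+2\delta},\ \varepsilon_2+2\delta)$-entanglement assisted code for $\mathcal N_{AB\to C}$. -/

import Mathlib

open scoped Kronecker ComplexOrder

universe u v w

/-! Registers are finite index types (a finite-dimensional Hilbert space with a fixed orthonormal
basis); operators on a register are complex matrices; a composite register is a product type. -/

/-- A quantum state: a positive semidefinite matrix of trace one. -/
structure IsState {A : Type u} [Fintype A] (ρ : Matrix A A ℂ) : Prop where
  posSemidef : ρ.PosSemidef
  trace_eq_one : ρ.trace = 1

/-- The operator `(Φ ⊗ id_R) X` for a linear map `Φ` from operators on `A` to operators on `B`. -/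
def applyLeft {A : Type u} {B : Type v} {R : Type w}
    (Φ : Matrix A A ℂ →ₗ[ℂ] Matrix B B ℂ) (X : Matrix (A × R) (A × R) ℂ) :
    Matrix (B × R) (B × R) ℂ :=
  Matrix.of fun p q => Φ (Matrix.of fun a a' => X (a, p.2) (a', q.2)) p.1 q.1

/-- A quantum channel: a completely positive and trace preserving linear map. -/
structure IsQuantumChannel {A : Type u} {B : Type v} [Fintype A] [Fintype B]
    (Φ : Matrix A A ℂ →ₗ[ℂ] Matrix B B ℂ) : Prop where
  completelyPositive : ∀ (k : ℕ) (X : Matrix (A × Fin k) (A × Fin k) ℂ),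
    X.PosSemidef → (applyLeft Φ X).PosSemidef
  tracePreserving : ∀ X : Matrix A A ℂ, (Φ X).trace = X.trace

/-- The marginal on `J` of an operator on `I`, tracing out `K`; the map `f` says how the basis
indices of `J` and `K` combine to a basis index of the composite register `I`. -/
def marginal {I : Type u} {J : Type v} {K : Type w} [Fintype K] (f : J → K → I)
    (ρ : Matrix I I ℂ) : Matrix J J ℂ :=
  Matrix.of fun j j' => ∑ k, ρ (f j k) (f j' k)

open Classical in
/-- `log₂ (1 / t)` for `t ≥ 0`, with value `+∞` at `t = 0`. -/
noncomputable def logInv (t : ℝ) : EReal :=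
  if t = 0 then ⊤ else ((Real.logb 2 (1 / t) : ℝ) : EReal)

/-- The smooth quantum hypothesis testing divergence `D_H^ε(ρ ‖ σ)`. -/
noncomputable def hypothesisDivergence {A : Type u} [Fintype A] [DecidableEq A]
    (ε : ℝ) (ρ σ : Matrix A A ℂ) : EReal :=
  ⨆ Λ ∈ {Λ : Matrix A A ℂ | Λ.PosSemidef ∧ (1 - Λ).PosSemidef ∧ 1 - ε ≤ (Λ * ρ).trace.re},
    logInv (Λ * σ).trace.re

/-- The density matrix `|θ⟩⟨θ|`. -/
def pureState {A : Type u} (θ : A → ℂ) : Matrix A A ℂ :=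
  Matrix.vecMulVec θ (star θ)

/-- The state on `X E_C` after a sender who holds `E` applies the encoding map `𝓔 : M E → X`
to the message `m` (that is, to `|m⟩⟨m|_M`) and to its half of the shared state `|θ⟩_{E E_C}`. -/
def encodedState {X E EC : Type u} {K : ℕ}
    (𝓔 : Matrix (Fin K × E) (Fin K × E) ℂ →ₗ[ℂ] Matrix X X ℂ) (θ : E × EC → ℂ) (m : Fin K) :
    Matrix (X × EC) (X × EC) ℂ :=
  applyLeft 𝓔 ((Matrix.single m m (1 : ℂ) ⊗ₖ pureState θ).submatrix
    (Equiv.prodAssoc (Fin K) E EC) (Equiv.prodAssoc (Fin K) E EC))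

/-- The output `M'₁M'₂` of the receiver when the messages `m₁, m₂` are sent: encoding by both
senders, the channel `N_{AB → C}`, and the decoding `𝓓 : C E_{C₁} E_{C₂} → M'₁M'₂`. -/
def decodedState {A B C EA EC₁ EB EC₂ : Type u} {K₁ K₂ : ℕ}
    (N : Matrix (A × B) (A × B) ℂ →ₗ[ℂ] Matrix C C ℂ)
    (θ₁ : EA × EC₁ → ℂ) (θ₂ : EB × EC₂ → ℂ)
    (𝓔₁ : Matrix (Fin K₁ × EA) (Fin K₁ × EA) ℂ →ₗ[ℂ] Matrix A A ℂ)
    (𝓔₂ : Matrix (Fin K₂ × EB) (Fin K₂ × EB) ℂ →ₗ[ℂ] Matrix B B ℂ)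
    (𝓓 : Matrix (C × (EC₁ × EC₂)) (C × (EC₁ × EC₂)) ℂ →ₗ[ℂ]
      Matrix (Fin K₁ × Fin K₂) (Fin K₁ × Fin K₂) ℂ)
    (m₁ : Fin K₁) (m₂ : Fin K₂) : Matrix (Fin K₁ × Fin K₂) (Fin K₁ × Fin K₂) ℂ :=
  𝓓 (applyLeft N ((encodedState 𝓔₁ θ₁ m₁ ⊗ₖ encodedState 𝓔₂ θ₂ m₂).submatrix
    (Equiv.prodProdProdComm A B EC₁ EC₂) (Equiv.prodProdProdComm A B EC₁ EC₂)))

/-- There is an `(R₁, R₂, ε₁, ε₂)`-entanglement assisted code for the multiple access channel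
`N_{AB → C}`. The message sets are `[2^{R₁}]` and `[2^{R₂}]`. Alice and the receiver share the pure
state `θ₁` on `E_A E_{C₁}`, Bob and the receiver share the pure state `θ₂` on `E_B E_{C₂}`. For
every pair of messages, the decoded `M'₁M'₂`, read in the computational basis, satisfies
`Pr(M'₁ ≠ m₁) ≤ ε₁` and `Pr(M'₂ ≠ m₂) ≤ ε₂`. -/
def HasEntanglementAssistedCode {A B C : Type u} [Fintype A] [Fintype B] [Fintype C]
    (N : Matrix (A × B) (A × B) ℂ →ₗ[ℂ] Matrix C C ℂ) (R₁ R₂ ε₁ ε₂ : ℝ) : Prop :=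
  ∃ (EA EC₁ EB EC₂ : Type u) (_ : Fintype EA) (_ : Fintype EC₁) (_ : Fintype EB) (_ : Fintype EC₂)
    (θ₁ : EA × EC₁ → ℂ) (θ₂ : EB × EC₂ → ℂ)
    (𝓔₁ : Matrix (Fin ⌊(2 : ℝ) ^ R₁⌋₊ × EA) (Fin ⌊(2 : ℝ) ^ R₁⌋₊ × EA) ℂ →ₗ[ℂ] Matrix A A ℂ)
    (𝓔₂ : Matrix (Fin ⌊(2 : ℝ) ^ R₂⌋₊ × EB) (Fin ⌊(2 : ℝ) ^ R₂⌋₊ × EB) ℂ →ₗ[ℂ] Matrix B B ℂ)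
    (𝓓 : Matrix (C × (EC₁ × EC₂)) (C × (EC₁ × EC₂)) ℂ →ₗ[ℂ]
      Matrix (Fin ⌊(2 : ℝ) ^ R₁⌋₊ × Fin ⌊(2 : ℝ) ^ R₂⌋₊)
        (Fin ⌊(2 : ℝ) ^ R₁⌋₊ × Fin ⌊(2 : ℝ) ^ R₂⌋₊) ℂ),
    ∑ i, ‖θ₁ i‖ ^ 2 = 1 ∧ ∑ i, ‖θ₂ i‖ ^ 2 = 1 ∧
    IsQuantumChannel 𝓔₁ ∧ IsQuantumChannel 𝓔₂ ∧ IsQuantumChannel 𝓓 ∧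
    ∀ m₁ m₂,
      ∑ p with p.1 ≠ m₁, (decodedState N θ₁ θ₂ 𝓔₁ 𝓔₂ 𝓓 m₁ m₂ p p).re ≤ ε₁ ∧
      ∑ p with p.2 ≠ m₂, (decodedState N θ₁ θ₂ 𝓔₁ 𝓔₂ 𝓓 m₁ m₂ p p).re ≤ ε₂

section InputState

/-! Marginals of a state `ψ_{ABA'B'A''B''}` on the six input registers. -/

variable {A B A' B' A'' B'' : Type u} [Fintype A] [Fintype B] [Fintype A'] [Fintype B']
  [Fintype A''] [Fintype B'']

/-- The condition `ψ_{ABA'B'A''B''} = ψ_{AA'A''} ⊗ ψ_{BB'B''}`. -/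
def IsSenderProduct
    (ψ : Matrix ((A × B) × (A' × B' × A'' × B'')) ((A × B) × (A' × B' × A'' × B'')) ℂ) : Prop :=
  ψ.submatrix
      (fun ((a, a', a''), (b, b', b'')) => ((a, b), (a', b', a'', b'')))
      (fun ((a, a', a''), (b, b', b'')) => ((a, b), (a', b', a'', b''))) =
    marginal (fun (a, a', a'') (b, b', b'') => ((a, b), (a', b', a'', b''))) ψ ⊗ₖ
    marginal (fun (b, b', b'') (a, a', a'') => ((a, b), (a', b', a'', b''))) ψ

/-- The condition `ψ_{A'B'A''B''} = ψ_{A'} ⊗ ψ_{A''} ⊗ ψ_{B'} ⊗ ψ_{B''}`. -/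
def IsReferenceProduct
    (ψ : Matrix ((A × B) × (A' × B' × A'' × B'')) ((A × B) × (A' × B' × A'' × B'')) ℂ) : Prop :=
  marginal (fun (((a', a''), b'), b'') (a, b) => ((a, b), (a', b', a'', b''))) ψ =
    marginal (fun a' (a, b, a'', b', b'') => ((a, b), (a', b', a'', b''))) ψ ⊗ₖ
    marginal (fun a'' (a, b, a', b', b'') => ((a, b), (a', b', a'', b''))) ψ ⊗ₖ
    marginal (fun b' (a, b, a', a'', b'') => ((a, b), (a', b', a'', b''))) ψ ⊗ₖ
    marginal (fun b'' (a, b, a', a'', b') => ((a, b), (a', b', a'', b''))) ψ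

end InputState

section OutputState

/-! The divergences of a state `ρ_{CA'B'A''B''}` that bound the rates. -/

variable {C A' B' A'' B'' : Type u} [Fintype C] [Fintype A'] [Fintype B'] [Fintype A'']
  [Fintype B''] [DecidableEq C] [DecidableEq A'] [DecidableEq B'] [DecidableEq A'']
  [DecidableEq B'']

/-- `D_H^ε(ρ_{A'CA''B''} ‖ ρ_{CA''B''} ⊗ ρ_{A'})`. -/
noncomputable def rateBound₁ (ε : ℝ)
    (ρ : Matrix (C × (A' × B' × A'' × B'')) (C × (A' × B' × A'' × B'')) ℂ) : EReal :=
  hypothesisDivergence ε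
    (marginal (fun ((c, a'', b''), a') b' => (c, (a', b', a'', b''))) ρ)
    (marginal (fun (c, a'', b'') (a', b') => (c, (a', b', a'', b''))) ρ ⊗ₖ
      marginal (fun a' (c, b', a'', b'') => (c, (a', b', a'', b''))) ρ)

/-- `D_H^ε(ρ_{B'CA''B''} ‖ ρ_{CA''B''} ⊗ ρ_{B'})`. -/
noncomputable def rateBound₂ (ε : ℝ)
    (ρ : Matrix (C × (A' × B' × A'' × B'')) (C × (A' × B' × A'' × B'')) ℂ) : EReal :=
  hypothesisDivergence ε
    (marginal (fun ((c, a'', b''), b') a' => (c, (a', b', a'', b''))) ρ)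
    (marginal (fun (c, a'', b'') (a', b') => (c, (a', b', a'', b''))) ρ ⊗ₖ
      marginal (fun b' (c, a', a'', b'') => (c, (a', b', a'', b''))) ρ)

end OutputState

/-!
The code is position-based. Alice shares with the receiver a purification of one copy of `ψ_{A''}`
and `⌊2 ^ R₁⌋` copies of `ψ_{A'}`, one for each message. Since `ψ_{A'A''} = ψ_{A'} ⊗ ψ_{A''}`, the
state in which position `m` holds the `A'` of `ψ_{AA'A''}` and the other positions hold independent
copies of `ψ_{A'}` has the same marginal at the receiver for every `m` (`marginal_positionState`).
Hence Alice can prepare it from the shared pure state by acting on her side only (`exists_encoder`).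
Bob does the same with `ψ_{BB'B''}`.

After the channel, position `j` of Alice is, together with `C A'' B''`, in the state `ρ_{A'CA''B''}`
if `j` is her message and in `ρ_{CA''B''} ⊗ ρ_{A'}` if not, whatever Bob has sent
(`marginal_receivedState₁`). So the message is found by discriminating tests that are nearly optimal
for `D_H`, one for each position. The Hayashi–Nagaoka inequality (`hayashiNagaoka`) bounds the error
of the square-root measurement by `ε₁ + 2 δ` (`exists_measurement_of_tests`). The tests can be taken
positive definite, since the union bound runs over the wrong messages only and so leaves some room
(`exists_posDef_test`); this makes the sum of the tests invertible.

The receiver measures one sender's message and then the other's. A gentle measurement bound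
(`re_trace_sqrt_mul_mul_sqrt_le`) shows that the first measurement, of error `e`, raises the error
of the second by at most `2 √e + e ≤ 3 √e` (`sequential_measurement`). The two orders of decoding
give the two codes.
-/

/-! ### Operator inequalities and measurements -/

section Operators
open scoped Matrix MatrixOrder

variable {H : Type*} [Fintype H]

theorem re_trace_mul_nonneg {X τ : Matrix H H ℂ} (hX : X.PosSemidef) (hτ : τ.PosSemidef) :
    0 ≤ (X * τ).trace.re := by
  classical
  obtain ⟨B, rfl⟩ := CStarAlgebra.nonneg_iff_eq_star_mul_self.mp hX.nonneg
  have h := (hτ.mul_mul_conjTranspose_same B).trace_nonneg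
  rw [Matrix.star_eq_conjTranspose, Matrix.mul_assoc, Matrix.trace_mul_comm]
  exact (Complex.nonneg_iff.mp h).1

theorem re_trace_mul_le {X Y τ : Matrix H H ℂ} (hXY : X ≤ Y) (hτ : τ.PosSemidef) :
    (X * τ).trace.re ≤ (Y * τ).trace.re := by
  have h := re_trace_mul_nonneg (Matrix.le_iff.mp hXY) hτ
  rwa [Matrix.sub_mul, Matrix.trace_sub, Complex.sub_re, sub_nonneg] at h

variable [DecidableEq H]

theorem mul_self_le_self {S : Matrix H H ℂ} (hS : 0 ≤ S) (hS1 : S ≤ 1) : S * S ≤ S := by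
  have hS' : 0 ≤ 1 - S := sub_nonneg.mpr hS1
  have h1 := IsSelfAdjoint.conjugate_nonneg hS (IsSelfAdjoint.of_nonneg hS')
  have h2 := IsSelfAdjoint.conjugate_nonneg hS' (IsSelfAdjoint.of_nonneg hS)
  rw [← sub_nonneg]
  convert add_nonneg h1 h2 using 1
  noncomm_ring

theorem sqrt_le_sqrt_of_le {S P : Matrix H H ℂ} (h : S ≤ P) : CFC.sqrt S ≤ CFC.sqrt P := by
  open scoped Matrix.Norms.L2Operator in
  exact CFC.sqrt_le_sqrt S P h

theorem sqrt_le_one_of_le_one {S : Matrix H H ℂ} (hS1 : S ≤ 1) : CFC.sqrt S ≤ 1 := by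
  have := sqrt_le_sqrt_of_le hS1
  rwa [CFC.sqrt_one] at this

theorem isUnit_det_sqrt {P : Matrix H H ℂ} (hP : P.PosDef) : IsUnit (CFC.sqrt P).det := by
  have h := (Matrix.isUnit_iff_isUnit_det _).mp hP.isUnit
  rw [← CFC.sqrt_mul_sqrt_self P hP.posSemidef.nonneg, Matrix.det_mul] at h
  exact isUnit_of_mul_isUnit_left h

theorem inv_sqrt_nonneg (P : Matrix H H ℂ) : 0 ≤ (CFC.sqrt P)⁻¹ :=
  (Matrix.nonneg_iff_posSemidef.mp (CFC.sqrt_nonneg P)).inv.nonneg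

theorem inv_sqrt_mul_mul_inv_sqrt {P : Matrix H H ℂ} (hP : P.PosDef) :
    (CFC.sqrt P)⁻¹ * P * (CFC.sqrt P)⁻¹ = 1 := by
  have hQ := isUnit_det_sqrt hP
  nth_rw 2 [← CFC.sqrt_mul_sqrt_self P hP.posSemidef.nonneg]
  rw [← mul_assoc, Matrix.nonsing_inv_mul _ hQ, one_mul, Matrix.mul_nonsing_inv _ hQ]

/-- The Hayashi–Nagaoka inequality
`1 - P^{-1/2} S P^{-1/2} ≤ (1 + c)(1 - S) + (2 + c + c⁻¹)(P - S)` for positive definite `P`. -/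
theorem hayashiNagaoka {S P : Matrix H H ℂ} (hS : 0 ≤ S) (hS1 : S ≤ 1) (hSP : S ≤ P)
    (hP : P.PosDef) {c : ℝ} (hc : 0 < c) :
    1 - (CFC.sqrt P)⁻¹ * S * (CFC.sqrt P)⁻¹ ≤
      (1 + c) • (1 - S) + (2 + c + c⁻¹) • (P - S) := by
  set Q := CFC.sqrt P with hQ
  have hQQ : Q * Q = P := CFC.sqrt_mul_sqrt_self P hP.posSemidef.nonneg
  have hQu : IsUnit Q.det := isUnit_det_sqrt hP
  have hXQ : Q⁻¹ * Q = 1 := Matrix.nonsing_inv_mul _ hQu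
  have hQX : Q * Q⁻¹ = 1 := Matrix.mul_nonsing_inv _ hQu
  have hX0 : 0 ≤ Q⁻¹ := inv_sqrt_nonneg P
  set X := Q⁻¹ with hX
  have hT : 0 ≤ P - S := sub_nonneg.mpr hSP
  -- `S ^ 2 ≤ S ≤ P`, and the square root is operator monotone
  have hSQ : S ≤ Q := by
    have h := sqrt_le_sqrt_of_le ((mul_self_le_self hS hS1).trans hSP)
    rwa [CFC.sqrt_mul_self S hS] at h
  have hXsa : IsSelfAdjoint (X - 1) := (IsSelfAdjoint.of_nonneg hX0).sub (.one _)
  -- the difference of the two sides is the sum of the following three nonnegative operators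
  have h1 : 0 ≤ c⁻¹ • ((1 - c • (X - 1)) * (P - S) * (1 - c • (X - 1))) :=
    smul_nonneg (by positivity) (IsSelfAdjoint.conjugate_nonneg hT
      ((IsSelfAdjoint.one _).sub ((IsSelfAdjoint.all c).smul hXsa)))
  have h2 : 0 ≤ (1 + c) • ((X - 1) * S * (X - 1)) :=
    smul_nonneg (by positivity) (IsSelfAdjoint.conjugate_nonneg hS hXsa)
  have h3 : 0 ≤ (2 * (1 + c)) • (Q - S) := smul_nonneg (by positivity) (sub_nonneg.mpr hSQ)
  have e1 : (X - 1) * P * (X - 1) = 1 - Q - Q + P := by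
    rw [← hQQ]
    calc (X - 1) * (Q * Q) * (X - 1) = (X * Q - Q) * (Q * X - Q) := by noncomm_ring
      _ = _ := by rw [hXQ, hQX]; noncomm_ring
  have e2 : X * P * X = 1 := inv_sqrt_mul_mul_inv_sqrt hP
  rw [← sub_nonneg]
  convert add_nonneg (add_nonneg h1 h2) h3 using 1
  set Y := X - 1 with hY
  set T := P - S with hT'
  have e3 : (1 - c • Y) * T * (1 - c • Y) =
      T - c • (Y * T) - c • (T * Y) + (c * c) • (Y * T * Y) := by
    simp only [mul_sub, sub_mul, smul_mul_assoc, mul_smul_comm, mul_one, one_mul, smul_sub,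
      smul_smul]
    abel
  have e4 : X * S * X = 1 - (T + Y * T + T * Y + Y * T * Y) := by
    rw [← e2, hT', hY]; noncomm_ring
  have e5 : Y * S * Y = 1 - Q - Q + (S + T) - Y * T * Y := by
    rw [show S + T = P by rw [hT']; abel, ← e1, hT']; noncomm_ring
  rw [e3, e4, e5]
  match_scalars <;> field_simp <;> ring

/-- A gentle measurement bound: if the outcome `Ω` is likely, then measuring it first hardly raises
the probability of `Q`. In the seminorm `‖X‖² = Tr(X τ X†)` this is the triangle inequality for
`√Q √Ω = √Q - √Q (1 - √Ω)`. -/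
theorem re_trace_sqrt_mul_mul_sqrt_le {Ω Q τ : Matrix H H ℂ} (hΩ : 0 ≤ Ω) (hΩ1 : Ω ≤ 1)
    (hQ : 0 ≤ Q) (hQ1 : Q ≤ 1) (hτ : τ.PosSemidef) (hτ1 : τ.trace = 1) :
    (CFC.sqrt Ω * Q * CFC.sqrt Ω * τ).trace.re ≤
      (Q * τ).trace.re + 2 * √(((1 - Ω) * τ).trace.re) := by
  set s := CFC.sqrt Ω with hs
  have hs0 : 0 ≤ s := CFC.sqrt_nonneg Ω
  have hss : s * s = Ω := CFC.sqrt_mul_sqrt_self Ω hΩ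
  have hs1 : s ≤ 1 := sqrt_le_one_of_le_one hΩ1
  have hsH : sᴴ = s := IsSelfAdjoint.of_nonneg hs0
  set q := CFC.sqrt Q with hq
  have hqq : q * q = Q := CFC.sqrt_mul_sqrt_self Q hQ
  have hqH : qᴴ = q := IsSelfAdjoint.of_nonneg (CFC.sqrt_nonneg Q)
  let _ := τ.toMatrixSeminormedAddCommGroup hτ
  let _ := τ.toMatrixInnerProductSpace hτ
  have key (X : Matrix H H ℂ) : ‖X‖ ^ 2 = (Xᴴ * X * τ).trace.re := by
    have h := @norm_sq_eq_re_inner ℂ (Matrix H H ℂ) _ _ _ X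
    have h' : inner ℂ X X = (X * τ * Xᴴ).trace := rfl
    rw [h, h', Matrix.mul_assoc, Matrix.trace_mul_comm, Matrix.mul_assoc, Matrix.trace_mul_comm]
    rfl
  have le_sqrt {X Y : Matrix H H ℂ} (h : Xᴴ * X ≤ Y) : ‖X‖ ≤ √((Y * τ).trace.re) :=
    Real.le_sqrt_of_sq_le (key X ▸ re_trace_mul_le h hτ)
  have hone : √(((1 : Matrix H H ℂ) * τ).trace.re) = 1 := by simp [hτ1]
  have hqs : (q * s)ᴴ * (q * s) = s * Q * s := by
    rw [Matrix.conjTranspose_mul, hsH, hqH, ← hqq]; noncomm_ring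
  have n1 : ‖q * s‖ ≤ 1 := by
    rw [← hone]
    refine le_sqrt (hqs ▸ ?_)
    have := IsSelfAdjoint.conjugate_le_conjugate hQ1 (IsSelfAdjoint.of_nonneg hs0)
    rw [mul_one, hss] at this
    exact this.trans hΩ1
  have n2 : ‖q‖ ≤ 1 := by
    rw [← hone]
    exact le_sqrt (by rwa [hqH, hqq])
  have n3 : ‖q * s - q‖ ≤ √(((1 - Ω) * τ).trace.re) := by
    refine le_sqrt ?_
    have e : (q * s - q)ᴴ * (q * s - q) = (1 - s) * Q * (1 - s) := by
      rw [Matrix.conjTranspose_sub, Matrix.conjTranspose_mul, hsH, hqH, ← hqq]; noncomm_ring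
    rw [e]
    have h1 := IsSelfAdjoint.conjugate_le_conjugate hQ1
      (IsSelfAdjoint.of_nonneg (sub_nonneg.mpr hs1))
    refine h1.trans ?_
    have h2 := sub_nonneg.mpr (mul_self_le_self hs0 hs1)
    rw [← sub_nonneg, ← hss]
    convert add_nonneg h2 h2 using 1
    noncomm_ring
  have n4 : ‖q * s‖ ≤ ‖q‖ + ‖q * s - q‖ := by
    simpa using norm_add_le q (q * s - q)
  have k1 := key (q * s)
  have k2 := key q
  rw [hqs] at k1
  rw [hqH, hqq] at k2
  rw [← k1, ← k2]
  nlinarith [norm_nonneg (q * s), norm_nonneg q, norm_nonneg (q * s - q)]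

/-- Measuring `Ω` and then `Ξ`: the first outcome keeps its error, say `p ≤ e₁`. The second outcome
errs with probability at most `e₂ + 2 √p` on the branch of the right first outcome and at most
`p ≤ √p` on the others together. -/
theorem sequential_measurement {ι κ : Type*} [Fintype ι] [Fintype κ] [DecidableEq ι]
    [DecidableEq κ] {Ω : ι → Matrix H H ℂ} {Ξ : κ → Matrix H H ℂ}
    (hΩ : ∀ i, 0 ≤ Ω i) (hΩs : ∑ i, Ω i = 1) (hΞ : ∀ j, 0 ≤ Ξ j) (hΞs : ∑ j, Ξ j = 1)
    {τ : Matrix H H ℂ} (hτ : τ.PosSemidef) (hτ1 : τ.trace = 1) {i₀ : ι} {j₀ : κ} {e₁ e₂ : ℝ}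
    (h₁ : ((1 - Ω i₀) * τ).trace.re ≤ e₁) (h₂ : ((1 - Ξ j₀) * τ).trace.re ≤ e₂) :
    ∑ p : ι × κ with p.1 ≠ i₀, (CFC.sqrt (Ω p.1) * Ξ p.2 * CFC.sqrt (Ω p.1) * τ).trace.re ≤ e₁ ∧
    ∑ p : ι × κ with p.2 ≠ j₀, (CFC.sqrt (Ω p.1) * Ξ p.2 * CFC.sqrt (Ω p.1) * τ).trace.re ≤
      e₂ + 3 * √e₁ := by
  have hΩ1 (i : ι) : Ω i ≤ 1 :=
    hΩs ▸ Finset.single_le_sum (fun i _ => hΩ i) (Finset.mem_univ i)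
  have hΞ1 (j : κ) : Ξ j ≤ 1 :=
    hΞs ▸ Finset.single_le_sum (fun j _ => hΞ j) (Finset.mem_univ j)
  have hss (i : ι) : CFC.sqrt (Ω i) * CFC.sqrt (Ω i) = Ω i :=
    CFC.sqrt_mul_sqrt_self (Ω i) (hΩ i)
  let f (i : ι) (X : Matrix H H ℂ) : ℝ := (CFC.sqrt (Ω i) * X * CFC.sqrt (Ω i) * τ).trace.re
  have fone (i : ι) : f i 1 = (Ω i * τ).trace.re := by simp only [f, mul_one, hss]
  have fsum (i : ι) : ∑ j, f i (Ξ j) = (Ω i * τ).trace.re := by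
    rw [← fone, ← hΞs]
    simp only [f, Finset.mul_sum, Finset.sum_mul, Matrix.trace_sum, Complex.re_sum]
  have fsub (i : ι) : ∑ j, (if j ≠ j₀ then f i (Ξ j) else 0) = f i (1 - Ξ j₀) := by
    rw [← Finset.sum_filter, Finset.filter_ne', Finset.sum_erase_eq_sub (Finset.mem_univ _), fsum,
      ← fone]
    simp only [f, mul_sub, sub_mul, Matrix.trace_sub, Complex.sub_re]
  have hp : ∑ i ∈ Finset.univ.erase i₀, (Ω i * τ).trace.re = ((1 - Ω i₀) * τ).trace.re := by
    rw [Finset.sum_erase_eq_sub (Finset.mem_univ _), ← Complex.re_sum, ← Matrix.trace_sum,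
      ← Finset.sum_mul, hΩs, sub_mul, Matrix.trace_sub, Complex.sub_re]
  set p := ((1 - Ω i₀) * τ).trace.re with hpdef
  have hp0 : 0 ≤ p := re_trace_mul_nonneg (Matrix.le_iff.mp (hΩ1 i₀)) hτ
  have hp1 : p ≤ 1 := by
    have h := re_trace_mul_le (sub_le_self 1 (hΩ i₀)) hτ
    rwa [one_mul, hτ1, Complex.one_re] at h
  constructor
  · rw [Finset.sum_filter, Fintype.sum_prod_type]
    refine le_of_eq_of_le ?_ h₁
    rw [← hp, ← Finset.filter_ne', Finset.sum_filter]
    refine Finset.sum_congr rfl fun i _ => ?_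
    by_cases hi : i = i₀
    · simp [hi]
    · simp only [ne_eq, hi, not_false_eq_true, if_true]
      exact fsum i
  · rw [Finset.sum_filter, Fintype.sum_prod_type]
    refine le_of_eq_of_le (Finset.sum_congr rfl fun i _ => fsub i) ?_
    rw [← Finset.add_sum_erase _ _ (Finset.mem_univ i₀)]
    have b1 : f i₀ (1 - Ξ j₀) ≤ ((1 - Ξ j₀) * τ).trace.re + 2 * √p :=
      re_trace_sqrt_mul_mul_sqrt_le (hΩ i₀) (hΩ1 i₀) (sub_nonneg.mpr (hΞ1 j₀))
        (sub_le_self 1 (hΞ j₀)) hτ hτ1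
    have b2 : ∑ i ∈ Finset.univ.erase i₀, f i (1 - Ξ j₀) ≤ p := by
      rw [← hp]
      refine Finset.sum_le_sum fun i _ => ?_
      rw [← fone]
      exact re_trace_mul_le (IsSelfAdjoint.conjugate_le_conjugate (sub_le_self 1 (hΞ j₀))
        (IsSelfAdjoint.of_nonneg (CFC.sqrt_nonneg _))) hτ
    have b3 : √p ≤ √e₁ := Real.sqrt_le_sqrt h₁
    have b4 : p ≤ √p := Real.le_sqrt_self_iff.mpr hp1
    linarith

/-- The joint measurement `√Ωᵢ Ξⱼ √Ωᵢ`, which performs `Ω` first and `Ξ` second. -/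
theorem exists_sequential_measurement {ι κ : Type*} [Fintype ι] [Fintype κ] [DecidableEq ι]
    [DecidableEq κ] {Ω : ι → Matrix H H ℂ} {Ξ : κ → Matrix H H ℂ}
    (hΩ : ∀ i, 0 ≤ Ω i) (hΩs : ∑ i, Ω i = 1) (hΞ : ∀ j, 0 ≤ Ξ j) (hΞs : ∑ j, Ξ j = 1) :
    ∃ E : ι × κ → Matrix H H ℂ, (∀ p, (E p).PosSemidef) ∧ ∑ p, E p = 1 ∧
      ∀ (τ : Matrix H H ℂ) (i₀ : ι) (j₀ : κ) (e₁ e₂ : ℝ), IsState τ →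
        ((1 - Ω i₀) * τ).trace.re ≤ e₁ → ((1 - Ξ j₀) * τ).trace.re ≤ e₂ →
        ∑ p with p.1 ≠ i₀, (E p * τ).trace.re ≤ e₁ ∧
        ∑ p with p.2 ≠ j₀, (E p * τ).trace.re ≤ e₂ + 3 * √e₁ := by
  refine ⟨fun p => CFC.sqrt (Ω p.1) * Ξ p.2 * CFC.sqrt (Ω p.1), fun p =>
    Matrix.nonneg_iff_posSemidef.mp
      (IsSelfAdjoint.conjugate_nonneg (hΞ p.2) (.of_nonneg (CFC.sqrt_nonneg _))), ?_,
    fun τ i₀ j₀ e₁ e₂ hτ h₁ h₂ =>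
      sequential_measurement hΩ hΩs hΞ hΞs hτ.posSemidef hτ.trace_eq_one h₁ h₂⟩
  rw [Fintype.sum_prod_type, ← hΩs]
  refine Finset.sum_congr rfl fun i _ => ?_
  dsimp only
  rw [← Finset.sum_mul, ← Finset.mul_sum, hΞs, mul_one, CFC.sqrt_mul_sqrt_self (Ω i) (hΩ i)]

/-- The square-root measurement `P^{-1/2} Λᵢ P^{-1/2}`, `P = ∑ᵢ Λᵢ`, of positive definite tests. -/
theorem exists_squareRoot_measurement {ι : Type*} [Fintype ι] [DecidableEq ι] [Nonempty ι]
    {Λ : ι → Matrix H H ℂ} (hΛ : ∀ i, (Λ i).PosDef) (hΛ1 : ∀ i, Λ i ≤ 1) :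
    ∃ Ω : ι → Matrix H H ℂ, (∀ i, 0 ≤ Ω i) ∧ ∑ i, Ω i = 1 ∧ ∀ i, ∀ c : ℝ, 0 < c →
      1 - Ω i ≤ (1 + c) • (1 - Λ i) + (2 + c + c⁻¹) • ∑ j ∈ Finset.univ.erase i, Λ j := by
  have hP : (∑ i, Λ i).PosDef := Matrix.posDef_sum Finset.univ_nonempty fun i _ => hΛ i
  have hΛ0 (i : ι) : 0 ≤ Λ i := (hΛ i).posSemidef.nonneg
  refine ⟨fun i => (CFC.sqrt (∑ i, Λ i))⁻¹ * Λ i * (CFC.sqrt (∑ i, Λ i))⁻¹,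
    fun i => IsSelfAdjoint.conjugate_nonneg (hΛ0 i) (.of_nonneg (inv_sqrt_nonneg _)), ?_,
    fun i c hc => ?_⟩
  · rw [← Finset.sum_mul, ← Finset.mul_sum, inv_sqrt_mul_mul_inv_sqrt hP]
  · rw [Finset.sum_erase_eq_sub (Finset.mem_univ i)]
    exact hayashiNagaoka (hΛ0 i) (hΛ1 i)
      (Finset.single_le_sum (fun i _ => hΛ0 i) (Finset.mem_univ i)) hP hc

/-- A measurement that identifies `i` with error at most `ε + 2 δ` on every state that the test `Λᵢ`
accepts with probability at least `1 - ε` and each other test with probability at most `t`, where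
`(|ι| - 1) t ≤ δ² / 4ε`. -/
theorem exists_measurement_of_tests {ι : Type*} [Fintype ι] [DecidableEq ι] [Nonempty ι]
    {Λ : ι → Matrix H H ℂ} (hΛ : ∀ i, (Λ i).PosDef) (hΛ1 : ∀ i, Λ i ≤ 1)
    {ε δ t : ℝ} (hδ : 0 < δ) (hδε : δ ≤ ε)
    (ht : ((Fintype.card ι : ℝ) - 1) * t ≤ δ ^ 2 / (4 * ε)) :
    ∃ Ω : ι → Matrix H H ℂ, (∀ i, 0 ≤ Ω i) ∧ ∑ i, Ω i = 1 ∧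
      ∀ (τ : Matrix H H ℂ) (i : ι), τ.PosSemidef → τ.trace = 1 → 1 - ε ≤ (Λ i * τ).trace.re →
        (∀ j ≠ i, (Λ j * τ).trace.re ≤ t) → ((1 - Ω i) * τ).trace.re ≤ ε + 2 * δ := by
  obtain ⟨Ω, h0, h1, h⟩ := exists_squareRoot_measurement hΛ hΛ1
  refine ⟨Ω, h0, h1, fun τ i hτ hτ1 hi hj => ?_⟩
  have hε : 0 < ε := hδ.trans_le hδε
  have hd : 0 < 2 * ε - δ := by linarith
  -- with this `c` the bound is `ε + 2 δ · ε / (2 ε - δ)`, where `2 ε - δ ≥ ε` because `δ ≤ ε`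
  have hc : 0 < δ / (2 * ε - δ) := by positivity
  have hle := re_trace_mul_le (h i _ hc) hτ
  set c := δ / (2 * ε - δ) with hcdef
  have e1 : ((1 - Λ i) * τ).trace.re ≤ ε := by
    rw [sub_mul, one_mul, Matrix.trace_sub, hτ1, Complex.sub_re, Complex.one_re]; linarith
  have e2 : ((∑ j ∈ Finset.univ.erase i, Λ j) * τ).trace.re ≤ δ ^ 2 / (4 * ε) := by
    refine le_trans ?_ ht
    rw [Finset.sum_mul, Matrix.trace_sum, Complex.re_sum]
    refine (Finset.sum_le_card_nsmul _ _ t fun j hj' => hj j (Finset.ne_of_mem_erase hj')).trans ?_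
    rw [nsmul_eq_mul, Finset.card_erase_of_mem (Finset.mem_univ i), Finset.card_univ,
      Nat.cast_sub Fintype.card_pos, Nat.cast_one]
  rw [add_mul, Matrix.trace_add, Complex.add_re, smul_mul_assoc, smul_mul_assoc,
    Matrix.trace_smul, Matrix.trace_smul, Complex.smul_re, Complex.smul_re, smul_eq_mul,
    smul_eq_mul] at hle
  have e3 : (1 + c) * ε + (2 + c + c⁻¹) * (δ ^ 2 / (4 * ε)) ≤ ε + 2 * δ := by
    have : (1 + c) * ε + (2 + c + c⁻¹) * (δ ^ 2 / (4 * ε)) = ε + ε * (2 * δ) / (2 * ε - δ) := by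
      rw [hcdef]; field_simp; ring
    rw [this, add_le_add_iff_left, div_le_iff₀ hd]
    nlinarith
  have e4 := mul_le_mul_of_nonneg_left e1 (show 0 ≤ 1 + c by positivity)
  have e5 := mul_le_mul_of_nonneg_left e2 (show 0 ≤ 2 + c + c⁻¹ by positivity)
  linarith

end Operators

/-! ### Tests from the hypothesis testing divergence -/

section Tests
open scoped Matrix MatrixOrder

theorem lt_of_lt_logInv {r t : ℝ} (ht : 0 ≤ t) (h : (r : EReal) < logInv t) :
    t * (2 : ℝ) ^ r < 1 := by
  unfold logInv at h
  split_ifs at h with h0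
  · simp [h0]
  · have ht' : 0 < t := lt_of_le_of_ne ht (Ne.symm h0)
    rw [EReal.coe_lt_coe_iff, Real.lt_logb_iff_rpow_lt (by norm_num) (by positivity),
      lt_div_iff₀ ht'] at h
    linarith

/-- Below the divergence there is a test `Λ` with the two error bounds that position-based decoding
needs, and it can be taken positive definite. The supremum need not be attained by the test:
replacing `K = ⌊2 ^ R⌋` by `K - 1` leaves room both for a test that is only nearly optimal and for
mixing it with a little of the identity. -/
theorem exists_posDef_test {H : Type*} [Fintype H] [DecidableEq H] {ρ σ : Matrix H H ℂ}
    (hρ : IsState ρ) (hσ : IsState σ) {ε δ R : ℝ} (hε : 0 < ε) (hδ : 0 < δ) (hR : 0 ≤ R)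
    (hrate : (R : EReal) ≤ hypothesisDivergence ε ρ σ -
      ((Real.logb 2 (4 * ε / δ ^ 2) : ℝ) : EReal)) :
    ∃ (Λ : Matrix H H ℂ) (t : ℝ), Λ.PosDef ∧ Λ ≤ 1 ∧ 1 - ε ≤ (Λ * ρ).trace.re ∧
      (Λ * σ).trace.re ≤ t ∧ ((⌊(2 : ℝ) ^ R⌋₊ : ℝ) - 1) * t ≤ δ ^ 2 / (4 * ε) := by
  set K := ⌊(2 : ℝ) ^ R⌋₊ with hK
  have hK1 : (1 : ℝ) ≤ K := by
    exact_mod_cast Nat.le_floor (by simpa using Real.one_le_rpow one_le_two hR)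
  have hKR : (K : ℝ) ≤ 2 ^ R := Nat.floor_le (by positivity)
  set q := δ ^ 2 / (4 * ε) with hq
  have hq0 : 0 < q := by positivity
  set r := R + Real.logb 2 (4 * ε / δ ^ 2) - Real.logb 2 ((K + 1) / K) with hr
  have hlog : 0 < Real.logb 2 (((K : ℝ) + 1) / K) :=
    Real.logb_pos one_lt_two (by rw [lt_div_iff₀ (by linarith)]; linarith)
  have h2r : (2 : ℝ) ^ r = 2 ^ R / q * (K / (K + 1)) := by
    rw [hr, Real.rpow_sub two_pos, Real.rpow_add two_pos,
      Real.rpow_logb two_pos (by norm_num) (by positivity),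
      Real.rpow_logb two_pos (by norm_num) (by positivity), hq]
    field_simp
  -- `r` lies below the divergence, and the margin `log ((K + 1) / K)` costs less than the factor
  -- `K / (K - 1)` at hand, since `(K - 1) (K + 1) < K ^ 2`
  have hD : (r : EReal) < hypothesisDivergence ε ρ σ := by
    have h1 := (EReal.le_sub_iff_add_le (by simp) (by simp)).mp hrate
    refine lt_of_lt_of_le ?_ h1
    rw [← EReal.coe_add, EReal.coe_lt_coe_iff]
    linarith
  unfold hypothesisDivergence at hD
  simp only [lt_iSup_iff] at hD
  obtain ⟨Λ, ⟨hΛ, hΛ1, hΛρ⟩, hΛσ⟩ := hD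
  set t₀ := (Λ * σ).trace.re with ht₀
  have ht₀0 : 0 ≤ t₀ := re_trace_mul_nonneg hΛ hσ.posSemidef
  have ht₀r := lt_of_lt_logInv ht₀0 hΛσ
  have hlt : ((K : ℝ) - 1) * t₀ < q := by
    have h1 : t₀ * (K * K) < q * (K + 1) := by
      have : t₀ * (2 ^ R * K) < q * (K + 1) := by
        rw [h2r] at ht₀r
        have h := mul_lt_mul_of_pos_right ht₀r (show 0 < q * ((K : ℝ) + 1) by positivity)
        have e : t₀ * (2 ^ R / q * (K / (K + 1))) * (q * ((K : ℝ) + 1)) = t₀ * (2 ^ R * K) := by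
          field_simp
        linarith
      refine lt_of_le_of_lt ?_ this
      gcongr
    nlinarith
  set η := min 1 ((q - (K - 1) * t₀) / K) with hη
  have hη0 : 0 < η := lt_min one_pos (div_pos (by linarith) (by linarith))
  have hη1 : η ≤ 1 := min_le_left _ _
  have hηK : K * η ≤ q - (K - 1) * t₀ := by
    have : η ≤ (q - (K - 1) * t₀) / K := min_le_right _ _
    rw [le_div_iff₀ (by linarith)] at this
    linarith
  have htr {ν : Matrix H H ℂ} (hν : ν.trace = 1) :
      (((1 - η) • Λ + η • (1 : Matrix H H ℂ)) * ν).trace.re =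
        (1 - η) * (Λ * ν).trace.re + η := by
    rw [add_mul, Matrix.trace_add, smul_mul_assoc, smul_mul_assoc, one_mul, Matrix.trace_smul,
      Matrix.trace_smul, hν]
    simp
  refine ⟨(1 - η) • Λ + η • 1, t₀ + η, ?_, ?_, ?_, ?_, ?_⟩
  · exact Matrix.PosDef.posSemidef_add (hΛ.smul (by linarith)) (Matrix.PosDef.one.smul hη0)
  · rw [Matrix.le_iff]
    have e : (1 : Matrix H H ℂ) - ((1 - η) • Λ + η • 1) = (1 - η) • (1 - Λ) := by module
    exact e ▸ hΛ1.smul (sub_nonneg.mpr hη1)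
  · rw [htr hρ.trace_eq_one]
    have h := re_trace_mul_nonneg hΛ1 hρ.posSemidef
    rw [sub_mul, one_mul, Matrix.trace_sub, hρ.trace_eq_one, Complex.sub_re, Complex.one_re] at h
    nlinarith
  · rw [htr hσ.trace_eq_one, ← ht₀]
    nlinarith
  · nlinarith
end Tests

/-! ### Quantum channels -/

section Channels
open scoped Matrix

/-- The map `X ↦ ∑ᵢ Vᵢ X Vᵢᴴ` with Kraus operators `Vᵢ`. -/
def krausMap {ι A B : Type*} [Fintype ι] [Fintype A] (V : ι → Matrix B A ℂ) :
    Matrix A A ℂ →ₗ[ℂ] Matrix B B ℂ where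
  toFun X := ∑ i, V i * X * (V i)ᴴ
  map_add' X Y := by simp only [Matrix.mul_add, Matrix.add_mul, Finset.sum_add_distrib]
  map_smul' c X := by
    simp only [Matrix.mul_smul, Matrix.smul_mul, Finset.smul_sum, RingHom.id_apply]

theorem krausMap_apply {ι A B : Type*} [Fintype ι] [Fintype A] (V : ι → Matrix B A ℂ)
    (X : Matrix A A ℂ) : krausMap V X = ∑ i, V i * X * (V i)ᴴ := rfl

theorem krausMap_apply_apply {ι A B : Type*} [Fintype ι] [Fintype A] (V : ι → Matrix B A ℂ)
    (X : Matrix A A ℂ) (b b' : B) :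
    krausMap V X b b' = ∑ i, ∑ a, ∑ a', V i b a * X a a' * star (V i b' a') := by
  simp only [krausMap_apply, Matrix.sum_apply, Matrix.mul_apply, Matrix.conjTranspose_apply,
    Finset.sum_mul]
  exact Finset.sum_congr rfl fun i _ => Finset.sum_comm

theorem isQuantumChannel_krausMap {ι : Type*} {A : Type u} {B : Type v} [Fintype ι] [Fintype A]
    [Fintype B] [DecidableEq A] {V : ι → Matrix B A ℂ} (hV : ∑ i, (V i)ᴴ * V i = 1) :
    IsQuantumChannel (krausMap V) where
  completelyPositive k X hX := by
    have h : applyLeft (krausMap V) X =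
        ∑ i, (V i ⊗ₖ (1 : Matrix (Fin k) (Fin k) ℂ)) * X *
          (V i ⊗ₖ (1 : Matrix (Fin k) (Fin k) ℂ))ᴴ := by
      ext ⟨b, r⟩ ⟨b', r'⟩
      simp [applyLeft, krausMap_apply, Matrix.sum_apply, Matrix.mul_apply, Fintype.sum_prod_type,
        Matrix.one_apply, apply_ite (starRingEnd ℂ)]
    rw [h]
    exact Matrix.posSemidef_sum _ fun i _ => hX.mul_mul_conjTranspose_same _
  tracePreserving X := by
    have h (i : ι) : (V i * X * (V i)ᴴ).trace = ((V i)ᴴ * V i * X).trace := by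
      rw [Matrix.trace_mul_comm, Matrix.mul_assoc]
    rw [krausMap_apply, Matrix.trace_sum, Finset.sum_congr rfl fun i _ => h i,
      ← Matrix.trace_sum, ← Matrix.sum_mul, hV, Matrix.one_mul]

/-- Complete positivity for an arbitrary finite ancilla instead of `Fin k`. -/
theorem IsQuantumChannel.posSemidef_applyLeft {A : Type u} {B : Type v} {R : Type*} [Fintype A]
    [Fintype B] [Fintype R] {Φ : Matrix A A ℂ →ₗ[ℂ] Matrix B B ℂ} (hΦ : IsQuantumChannel Φ)
    {X : Matrix (A × R) (A × R) ℂ} (hX : X.PosSemidef) : (applyLeft Φ X).PosSemidef := by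
  let e := Fintype.equivFin R
  have h := (hΦ.completelyPositive _ _ (hX.submatrix (Prod.map id e.symm))).submatrix
    (Prod.map id e)
  convert h using 1
  ext ⟨b, r⟩ ⟨b', r'⟩
  simp [applyLeft]

theorem IsQuantumChannel.isState_applyLeft {A : Type u} {B : Type v} {R : Type*} [Fintype A]
    [Fintype B] [Fintype R] {Φ : Matrix A A ℂ →ₗ[ℂ] Matrix B B ℂ} (hΦ : IsQuantumChannel Φ)
    {X : Matrix (A × R) (A × R) ℂ} (hX : IsState X) : IsState (applyLeft Φ X) where
  posSemidef := hΦ.posSemidef_applyLeft hX.posSemidef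
  trace_eq_one := by
    rw [← hX.trace_eq_one]
    simp only [Matrix.trace, Matrix.diag, Fintype.sum_prod_type_right, applyLeft, Matrix.of_apply]
    exact Finset.sum_congr rfl fun r _ => hΦ.tracePreserving _

/-- Performing the measurement `E` and recording the outcome is a quantum channel. -/
theorem exists_channel_of_measurement {ι : Type u} {H : Type v} [Fintype ι] [DecidableEq ι]
    [Fintype H] [DecidableEq H] {E : ι → Matrix H H ℂ} (hE : ∀ p, (E p).PosSemidef)
    (hE1 : ∑ p, E p = 1) :
    ∃ 𝓓 : Matrix H H ℂ →ₗ[ℂ] Matrix ι ι ℂ, IsQuantumChannel 𝓓 ∧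
      ∀ X p, 𝓓 X p p = (E p * X).trace := by
  open scoped MatrixOrder in
  choose F hF using fun p => CStarAlgebra.nonneg_iff_eq_star_mul_self.mp (hE p).nonneg
  simp only [Matrix.star_eq_conjTranspose] at hF
  let V (i : ι × H) : Matrix ι H ℂ := Matrix.of fun q h => if q = i.1 then F i.1 i.2 h else 0
  refine ⟨krausMap V, isQuantumChannel_krausMap ?_, fun X p => ?_⟩
  · rw [← hE1]
    ext h h'
    simp [V, Matrix.sum_apply, Matrix.mul_apply, hF, Fintype.sum_prod_type]
  · rw [hF, Matrix.mul_assoc, Matrix.trace_mul_comm, krausMap_apply]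
    simp [V, Matrix.sum_apply, Matrix.mul_apply, Fintype.sum_prod_type, Matrix.trace,
      apply_ite]
end Channels

/-! ### Encoding by steering a pure state -/

section Encoder
open scoped Matrix

/-- A positive semidefinite `ω` factors through its support: `ω = W Wᴴ` with `W` left invertible.
`E` indexes the nonzero eigenvalues. -/
theorem Matrix.PosSemidef.exists_factor_leftInverse {H : Type u} [Fintype H] {ω : Matrix H H ℂ}
    (hω : ω.PosSemidef) : ∃ (E : Type u) (_ : Fintype E) (_ : DecidableEq E) (W : Matrix H E ℂ)
      (L : Matrix E H ℂ), ω = W * Wᴴ ∧ L * W = 1 := by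
  classical
  let p := hω.isHermitian.eigenvalues
  let U : Matrix H H ℂ := hω.isHermitian.eigenvectorUnitary
  have hU : Uᴴ * U = 1 := Unitary.coe_star_mul_self hω.isHermitian.eigenvectorUnitary
  have hp (i : {i // p i ≠ 0}) : 0 < p i := lt_of_le_of_ne (hω.eigenvalues_nonneg i) (Ne.symm i.2)
  refine ⟨{i // p i ≠ 0}, inferInstance, inferInstance,
    Matrix.of fun h i => U h i * (√(p i) : ℝ), Matrix.of fun i h => ((√(p i))⁻¹ : ℝ) * star (U h i),
    ?_, ?_⟩
  · have hs : ω = U * Matrix.diagonal (fun i => (p i : ℂ)) * Uᴴ := by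
      have h := hω.isHermitian.spectral_theorem
      rw [Unitary.conjStarAlgAut_apply] at h
      exact h
    ext h h'
    have e := congrFun (congrFun hs h) h'
    rw [Matrix.mul_apply] at e
    simp only [Matrix.mul_diagonal, Matrix.conjTranspose_apply] at e
    rw [e, ← Finset.sum_filter_of_ne (p := fun i => p i ≠ 0) fun i _ hi h0 => hi (by simp [h0]),
      ← Finset.sum_subtype_eq_sum_filter, Finset.subtype_univ, Matrix.mul_apply]
    refine Finset.sum_congr rfl fun i _ => ?_
    have hi : (p i : ℂ) = (√(p i) : ℝ) * (√(p i) : ℝ) := by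
      rw [← Complex.ofReal_mul, Real.mul_self_sqrt (hp i).le]
    rw [hi]
    simp
    ring
  · ext i j
    have e := congrFun (congrFun hU i) j
    rw [Matrix.mul_apply] at e ⊢
    simp only [Matrix.of_apply, Matrix.conjTranspose_apply] at e ⊢
    have hij : ∑ h, (((√(p i))⁻¹ : ℝ) : ℂ) * star (U h i) * (U h j * (√(p j) : ℝ)) =
        (((√(p i))⁻¹ : ℝ) : ℂ) * (√(p j) : ℝ) * ∑ h, star (U h i) * U h j := by
      rw [Finset.mul_sum]
      exact Finset.sum_congr rfl fun h _ => by ring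
    rw [hij, e]
    by_cases h : i = j
    · subst h
      have := (Real.sqrt_pos.mpr (hp i)).ne'
      rw [Matrix.one_apply_eq, Matrix.one_apply_eq, mul_one, ← Complex.ofReal_mul,
        inv_mul_cancel₀ this, Complex.ofReal_one]
    · rw [Matrix.one_apply_ne h, Matrix.one_apply_ne (Subtype.coe_ne_coe.mpr h), mul_zero]

/-- States `Φ m` on `A EC` with a common marginal `ω` on `EC` can all be prepared from one
purification `θ` of `ω` by operations on the purifying register `E` alone. With `ω = W Wᴴ`, `L W = 1`
and `Φ m = ∑ᵣ |Gᵣ⟩⟨Gᵣ|`, the purification is `W` and the Kraus operators for the message `m` are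
`Gᵣ Lᵀ`. -/
theorem exists_encoder {A EC : Type u} [Fintype A] [Fintype EC] {K : ℕ} {ω : Matrix EC EC ℂ}
    (hω : IsState ω) {Φ : Fin K → Matrix (A × EC) (A × EC) ℂ} (hΦ : ∀ m, (Φ m).PosSemidef)
    (hΦω : ∀ m, marginal (fun c a => (a, c)) (Φ m) = ω) :
    ∃ (E : Type u) (_ : Fintype E) (θ : E × EC → ℂ)
      (𝓔 : Matrix (Fin K × E) (Fin K × E) ℂ →ₗ[ℂ] Matrix A A ℂ),
      ∑ i, ‖θ i‖ ^ 2 = 1 ∧ IsQuantumChannel 𝓔 ∧ ∀ m, encodedState 𝓔 θ m = Φ m := by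
  classical
  obtain ⟨E, _, _, W, L, hW, hL⟩ := hω.posSemidef.exists_factor_leftInverse
  open scoped MatrixOrder in
  choose F hF using fun m => CStarAlgebra.nonneg_iff_eq_star_mul_self.mp (hΦ m).nonneg
  let G (m : Fin K) (r : A × EC) : Matrix A EC ℂ := Matrix.of fun a c => star (F m r (a, c))
  have hG (m : Fin K) (a a' : A) (c c' : EC) :
      Φ m (a, c) (a', c') = ∑ r, G m r a c * star (G m r a' c') := by
    rw [hF m, Matrix.star_eq_conjTranspose]
    simp [Matrix.mul_apply, G]
  have hωG (m : Fin K) : ω = ∑ r, (G m r)ᵀ * ((G m r)ᵀ)ᴴ := by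
    ext c c'
    rw [← hΦω m, marginal, Matrix.of_apply, Matrix.sum_apply,
      Finset.sum_congr rfl fun a _ => hG m a a c c', Finset.sum_comm]
    rfl
  -- `W L` is the identity on the support of `ω`, which contains the range of every `Gᵣᵀ`
  have hGW (m : Fin K) (r : A × EC) : (G m r * Lᵀ) * Wᵀ = G m r := by
    let D (r : A × EC) : Matrix EC A ℂ := (W * L - 1) * (G m r)ᵀ
    have h0 : ∑ r, (D r * (D r)ᴴ).trace = 0 := by
      have : ∑ r, D r * (D r)ᴴ = (W * L - 1) * ω * (W * L - 1)ᴴ := by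
        rw [hωG m, Matrix.mul_sum, Matrix.sum_mul]
        simp only [D, Matrix.conjTranspose_mul, Matrix.mul_assoc]
      rw [← Matrix.trace_sum, this, hW, ← Matrix.mul_assoc, Matrix.sub_mul, Matrix.mul_assoc W L W,
        hL, Matrix.mul_one, Matrix.one_mul, sub_self]
      simp
    have h1 := (Finset.sum_eq_zero_iff_of_nonneg fun r _ =>
      (Matrix.posSemidef_self_mul_conjTranspose (D r)).trace_nonneg).mp h0 r (Finset.mem_univ r)
    have h2 : D r = 0 := Matrix.trace_mul_conjTranspose_self_eq_zero_iff.mp h1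
    have h3 : W * L * (G m r)ᵀ = (G m r)ᵀ := by
      simpa [D, Matrix.sub_mul, sub_eq_zero] using h2
    have h4 := congrArg Matrix.transpose h3
    rwa [Matrix.transpose_mul, Matrix.transpose_mul, Matrix.transpose_transpose,
      ← Matrix.mul_assoc] at h4
  -- trace preservation is `L ω Lᴴ = 1`
  have hTP (m : Fin K) : ∑ r, (G m r * Lᵀ)ᴴ * (G m r * Lᵀ) = 1 := by
    have h : ∑ r, (G m r * Lᵀ)ᴴ * (G m r * Lᵀ) = (L * ω * Lᴴ)ᵀ := by
      rw [hωG m, Matrix.mul_sum, Matrix.sum_mul, Matrix.transpose_sum]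
      refine Finset.sum_congr rfl fun r _ => ?_
      simp only [Matrix.conjTranspose_mul, Matrix.transpose_mul, Matrix.transpose_transpose,
        Matrix.mul_assoc]
      rfl
    rw [h, hW, ← Matrix.mul_assoc, hL, Matrix.one_mul, ← Matrix.conjTranspose_mul, hL,
      Matrix.conjTranspose_one, Matrix.transpose_one]
  let V (i : Fin K × (A × EC)) : Matrix A (Fin K × E) ℂ :=
    Matrix.of fun a x => if x.1 = i.1 then (G i.1 i.2 * Lᵀ) a x.2 else 0
  refine ⟨E, inferInstance, fun x => W x.2 x.1, krausMap V, ?_, isQuantumChannel_krausMap ?_, ?_⟩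
  · have h := hω.trace_eq_one
    rw [hW] at h
    simp only [Matrix.trace, Matrix.diag, Matrix.mul_apply, Matrix.conjTranspose_apply] at h
    rw [Fintype.sum_prod_type_right]
    apply Complex.ofReal_injective
    rw [Complex.ofReal_one, ← h]
    push_cast
    simp [Complex.mul_conj']
  · ext ⟨m, e⟩ ⟨m', e'⟩
    have h := congrFun (congrFun (hTP m) e) e'
    simp only [Matrix.sum_apply, Matrix.mul_apply (M := (_)ᴴ), Matrix.conjTranspose_apply] at h
    rw [Matrix.sum_apply, Fintype.sum_prod_type, Finset.sum_eq_single m]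
    · by_cases hm : m' = m
      · subst hm
        simpa [V, Matrix.mul_apply (M := (_)ᴴ), Matrix.one_apply] using h
      · simp [V, Matrix.mul_apply (M := (_)ᴴ), hm, Ne.symm hm]
    · intro n _ hn
      simp [V, Matrix.mul_apply (M := (_)ᴴ), Ne.symm hn]
    · simp
  · intro m
    ext ⟨a, c⟩ ⟨a', c'⟩
    rw [hG, encodedState, applyLeft, Matrix.of_apply, krausMap_apply_apply, Fintype.sum_prod_type,
      Finset.sum_eq_single m]
    · refine Finset.sum_congr rfl fun r _ => ?_
      have h1 := congrFun (congrFun (hGW m r) a) c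
      have h2 := congrFun (congrFun (hGW m r) a') c'
      rw [← h1, ← h2, Matrix.mul_apply (N := Wᵀ), Matrix.mul_apply (N := Wᵀ), star_sum,
        Finset.sum_mul_sum, Fintype.sum_prod_type, Finset.sum_eq_single m]
      · refine Finset.sum_congr rfl fun e _ => ?_
        rw [Fintype.sum_prod_type, Finset.sum_eq_single m]
        · refine Finset.sum_congr rfl fun e' _ => ?_
          simp [V, pureState, Matrix.vecMulVec_apply]
          ring
        · intro n _ hn
          simp [V, hn]
        · simp
      · intro n _ hn
        simp [V, hn]
      · simp
    · intro n _ hn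
      refine Finset.sum_eq_zero fun r _ => Finset.sum_eq_zero fun x _ =>
        Finset.sum_eq_zero fun y _ => ?_
      by_cases hx : x.1 = n
      · simp [V, hx, Matrix.single_apply, Ne.symm hn]
      · simp [V, hx]
    · simp
end Encoder

/-! ### Marginals and tests on a subsystem -/

section Marginals
open scoped Matrix MatrixOrder

theorem Matrix.PosSemidef.marginal {I J K : Type*} [Fintype K] {f : J → K → I}
    {ρ : Matrix I I ℂ} (hρ : ρ.PosSemidef) : (marginal f ρ).PosSemidef := by
  have h : _root_.marginal f ρ = ∑ k, ρ.submatrix (f · k) (f · k) := by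
    ext j j'
    simp [_root_.marginal, Matrix.sum_apply]
  rw [h]
  exact Matrix.posSemidef_sum _ fun k _ => hρ.submatrix _

theorem IsState.marginal {I J K : Type*} [Fintype I] [Fintype J] [Fintype K] {f : J → K → I}
    (hf : Function.Bijective fun p : J × K => f p.1 p.2) {ρ : Matrix I I ℂ} (hρ : IsState ρ) :
    IsState (marginal f ρ) where
  posSemidef := hρ.posSemidef.marginal
  trace_eq_one := by
    rw [← hρ.trace_eq_one]
    simp only [Matrix.trace, Matrix.diag, _root_.marginal, Matrix.of_apply]
    rw [← Fintype.sum_prod_type']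
    exact Fintype.sum_bijective _ hf _ _ fun _ => rfl

theorem IsState.kronecker {I J : Type*} [Fintype I] [Fintype J] {ρ : Matrix I I ℂ}
    {σ : Matrix J J ℂ} (hρ : IsState ρ) (hσ : IsState σ) : IsState (ρ ⊗ₖ σ) where
  posSemidef := hρ.posSemidef.kronecker hσ.posSemidef
  trace_eq_one := by rw [Matrix.trace_kronecker, hρ.trace_eq_one, hσ.trace_eq_one, one_mul]

theorem IsState.submatrix_equiv {I J : Type*} [Fintype I] [Fintype J] {ρ : Matrix I I ℂ}
    (hρ : IsState ρ) (e : J ≃ I) : IsState (ρ.submatrix e e) where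
  posSemidef := hρ.posSemidef.submatrix e
  trace_eq_one := by
    rw [← hρ.trace_eq_one]
    exact Equiv.sum_comp e fun i => ρ i i

/-- The test `Λ` on the part `J` of the composite register `I`, that is, `Λ ⊗ 1_K`; the equivalence
`e` splits `I` into `J` and `K`. -/
def liftTest {I J K : Type*} [DecidableEq K] (e : J × K ≃ I) (Λ : Matrix J J ℂ) : Matrix I I ℂ :=
  (Λ ⊗ₖ (1 : Matrix K K ℂ)).submatrix e.symm e.symm

theorem posDef_liftTest {I J K : Type*} [Fintype J] [Fintype K] [DecidableEq K] (e : J × K ≃ I)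
    {Λ : Matrix J J ℂ} (hΛ : Λ.PosDef) : (liftTest e Λ).PosDef :=
  (hΛ.kronecker .one).submatrix e.symm.injective

theorem liftTest_le_one {I J K : Type*} [Fintype J] [Fintype K] [DecidableEq I] [DecidableEq J]
    [DecidableEq K] (e : J × K ≃ I) {Λ : Matrix J J ℂ} (hΛ : Λ ≤ 1) : liftTest e Λ ≤ 1 := by
  have h := ((Matrix.le_iff.mp hΛ).kronecker
    (Matrix.PosSemidef.one (n := K) (R := ℂ))).submatrix e.symm
  have e1 : (1 : Matrix I I ℂ) - liftTest e Λ =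
      ((1 - Λ) ⊗ₖ (1 : Matrix K K ℂ)).submatrix e.symm e.symm := by
    have e0 : (1 : Matrix I I ℂ) =
        ((1 : Matrix J J ℂ) ⊗ₖ (1 : Matrix K K ℂ)).submatrix e.symm e.symm := by
      rw [Matrix.one_kronecker_one, Matrix.submatrix_one_equiv]
    rw [e0, liftTest]
    ext i i'
    simp only [Matrix.sub_apply, Matrix.submatrix_apply, Matrix.kroneckerMap_apply, sub_mul]
  rw [Matrix.le_iff, e1]
  exact h

/-- The acceptance probability of a test on `J` depends on the marginal on `J` only. -/
theorem trace_liftTest_mul {I J K : Type*} [Fintype I] [Fintype J] [Fintype K] [DecidableEq K]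
    (e : J × K ≃ I) (Λ : Matrix J J ℂ) (τ : Matrix I I ℂ) :
    (liftTest e Λ * τ).trace = (Λ * marginal (fun j k => e (j, k)) τ).trace := by
  simp only [Matrix.trace, Matrix.diag, Matrix.mul_apply, liftTest, Matrix.submatrix_apply,
    marginal, Matrix.of_apply]
  rw [← Equiv.sum_comp e]
  simp_rw [← Equiv.sum_comp e (fun i => _ * τ i _)]
  simp only [Fintype.sum_prod_type, Matrix.kroneckerMap_apply, Equiv.symm_apply_apply,
    Matrix.one_apply, Finset.mul_sum]
  simp
  refine Finset.sum_congr rfl fun j _ => ?_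
  rw [Finset.sum_comm]

/-- Partial traces over the reference commute with a map on the other register. -/
theorem sum_applyLeft_apply {A : Type u} {B : Type v} {R k : Type*} [Fintype k]
    (Φ : Matrix A A ℂ →ₗ[ℂ] Matrix B B ℂ) (X : Matrix (A × R) (A × R) ℂ) (g g' : k → R) (b b' : B) :
    ∑ i, applyLeft Φ X (b, g i) (b', g' i) =
      Φ (Matrix.of fun a a' => ∑ i, X (a, g i) (a', g' i)) b b' := by
  have h : (Matrix.of fun a a' => ∑ i, X (a, g i) (a', g' i)) =
      ∑ i, Matrix.of fun a a' => X (a, g i) (a', g' i) := by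
    ext a a'
    simp [Matrix.sum_apply]
  rw [h, map_sum, Matrix.sum_apply]
  rfl

end Marginals

/-! ### Position states -/

section Positions
variable {A D F : Type*} {ι : Type*} [Fintype ι] [DecidableEq ι]

/-- The marginal at position `j` of the product operator `⨂ᵢ gᵢ`. -/
theorem sum_prod_funSplitAt [Fintype D] (g : ι → Matrix D D ℂ) (j : ι) (v v' : D) :
    ∑ z, ∏ i, g i ((Equiv.funSplitAt j D).symm (v, z) i) ((Equiv.funSplitAt j D).symm (v', z) i) =
      g j v v' * ∏ i : {i // i ≠ j}, (g i).trace := by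
  have h (z : {i // i ≠ j} → D) :
      ∏ i, g i ((Equiv.funSplitAt j D).symm (v, z) i) ((Equiv.funSplitAt j D).symm (v', z) i) =
      g j v v' * ∏ i : {i // i ≠ j}, g i (z i) (z i) := by
    rw [Fintype.prod_eq_mul_prod_subtype_ne _ j]
    congr 1
    · simp
    · exact Finset.prod_congr rfl fun i _ => by simp [i.2]
  simp_rw [h]
  rw [← Finset.mul_sum]
  simp only [Matrix.trace, Matrix.diag, Finset.prod_univ_sum, Fintype.piFinset_univ]

theorem posSemidef_prod {I : Type*} [Finite I] {M : ι → Matrix I I ℂ} (hM : ∀ i, (M i).PosSemidef) :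
    (Matrix.of fun p q => ∏ i, M i p q).PosSemidef := by
  have key (s : Finset ι) : (Matrix.of fun p q => ∏ i ∈ s, M i p q).PosSemidef := by
    induction s using Finset.induction_on with
    | empty =>
      convert Matrix.posSemidef_vecMulVec_self_star (1 : I → ℂ) using 1
      ext p q
      simp [Matrix.vecMulVec_apply]
    | insert i s hi ih =>
      have e : (Matrix.of fun p q => ∏ i ∈ insert i s, M i p q) =
          (M i).hadamard (Matrix.of fun p q => ∏ i ∈ s, M i p q) := by
        ext p q
        simp [Finset.prod_insert hi]
      rw [e]
      exact (hM i).hadamard ih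
  exact key _

/-- The state `φ_{A D_m F} ⊗ ⨂_{i ≠ m} α_{D_i}` that a sender with the message `m` prepares on its
channel input `A` and the positions `D_i` and the register `F` of the receiver. All positions enter
in one product over `ι`, with the entries of `φ` at position `m`. -/
def positionState (φ : Matrix (A × D × F) (A × D × F) ℂ) (α : Matrix D D ℂ) (m : ι) :
    Matrix (A × ((ι → D) × F)) (A × ((ι → D) × F)) ℂ :=
  Matrix.of fun (a, (x, s)) (a', (x', s')) =>
    ∏ i, (if i = m then Matrix.of fun v v' => φ (a, v, s) (a', v', s') else α) (x i) (x' i)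

theorem posSemidef_positionState [Finite A] [Finite D] [Finite F]
    {φ : Matrix (A × D × F) (A × D × F) ℂ} {α : Matrix D D ℂ}
    (hφ : φ.PosSemidef) (hα : α.PosSemidef) (m : ι) : (positionState φ α m).PosSemidef := by
  let M (i : ι) : Matrix (A × ((ι → D) × F)) (A × ((ι → D) × F)) ℂ :=
    if i = m then φ.submatrix (fun p => (p.1, p.2.1 i, p.2.2)) (fun p => (p.1, p.2.1 i, p.2.2))
    else α.submatrix (fun p => p.2.1 i) (fun p => p.2.1 i)
  have hM (i : ι) : (M i).PosSemidef := by
    by_cases h : i = m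
    · simpa only [M, h, if_true] using hφ.submatrix _
    · simpa only [M, h, if_false] using hα.submatrix _
  convert posSemidef_prod hM using 1
  ext ⟨a, x, s⟩ ⟨a', x', s'⟩
  refine Finset.prod_congr rfl fun i _ => ?_
  by_cases h : i = m
  · simp [M, h]
  · simp [M, h]

/-- Position `j` of a position state is correlated with the rest for `j = m` and independent of it
otherwise. -/
theorem sum_positionState_split [Fintype D] {φ : Matrix (A × D × F) (A × D × F) ℂ}
    {α : Matrix D D ℂ} (hα : α.trace = 1) (m j : ι) (a a' : A) (s s' : F) (v v' : D) :
    ∑ z, positionState φ α m (a, ((Equiv.funSplitAt j D).symm (v, z), s))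
        (a', ((Equiv.funSplitAt j D).symm (v', z), s')) =
      if j = m then φ (a, v, s) (a', v', s') else α v v' * ∑ u, φ (a, u, s) (a', u, s') := by
  refine (sum_prod_funSplitAt _ j v v').trans ?_
  split_ifs with h
  · subst h
    rw [Finset.prod_eq_one fun i _ => by rw [if_neg i.2, hα], mul_one]
    rfl
  · rw [Finset.prod_eq_single ⟨m, Ne.symm h⟩]
    · rw [if_pos rfl]; rfl
    · intro i _ hi
      rw [if_neg fun h' => hi (Subtype.ext h'), hα]
    · simp

theorem sum_positionState [Fintype D] {φ : Matrix (A × D × F) (A × D × F) ℂ} {α : Matrix D D ℂ}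
    (hα : α.trace = 1) (m : ι) (a a' : A) (s s' : F) :
    ∑ x, positionState φ α m (a, (x, s)) (a', (x, s')) = ∑ u, φ (a, u, s) (a', u, s') := by
  rw [← Equiv.sum_comp (Equiv.funSplitAt m D).symm, Fintype.sum_prod_type]
  exact Finset.sum_congr rfl fun v _ =>
    (sum_positionState_split hα m m a a' s s' v v).trans (if_pos rfl)

/-- If `φ_{DF} = α ⊗ β`, then the receiver's part of a position state does not depend on the
message, so that one shared pure state serves all messages. -/
theorem marginal_positionState [Fintype A] {φ : Matrix (A × D × F) (A × D × F) ℂ} {α : Matrix D D ℂ}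
    {β : Matrix F F ℂ} (hφ : ∀ v v' s s', ∑ a, φ (a, v, s) (a, v', s') = α v v' * β s s') (m : ι) :
    marginal (fun c a => (a, c)) (positionState φ α m) =
      Matrix.of fun p q => (∏ i, α (p.1 i) (q.1 i)) * β p.2 q.2 := by
  ext ⟨x, s⟩ ⟨x', s'⟩
  simp only [marginal, Matrix.of_apply, positionState]
  simp_rw [Fintype.prod_eq_mul_prod_subtype_ne _ m, if_true]
  have h (a : A) : ∏ i : {i // i ≠ m}, (if (i : ι) = m then
      Matrix.of fun v v' => φ (a, v, s) (a, v', s') else α) (x i) (x' i) =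
      ∏ i : {i // i ≠ m}, α (x i) (x' i) :=
    Finset.prod_congr rfl fun i _ => by rw [if_neg i.2]
  simp_rw [h]
  rw [← Finset.sum_mul, mul_right_comm, ← hφ]
  rfl

theorem isState_positionMarginal [Fintype D] [Fintype F] {α : Matrix D D ℂ}
    {β : Matrix F F ℂ} (hα : IsState α) (hβ : IsState β) :
    IsState (Matrix.of fun p q : (ι → D) × F => (∏ i, α (p.1 i) (q.1 i)) * β p.2 q.2) where
  posSemidef :=
    (posSemidef_prod fun i : ι => hα.posSemidef.submatrix fun x : ι → D => x i).kronecker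
      hβ.posSemidef
  trace_eq_one := by
    simp only [Matrix.trace, Matrix.diag, Matrix.of_apply, Fintype.sum_prod_type]
    have h : ∑ x : ι → D, ∏ i, α (x i) (x i) = ∏ _i : ι, α.trace := by
      simp only [Matrix.trace, Matrix.diag, Finset.prod_univ_sum, Fintype.piFinset_univ]
    have hβ1 : ∑ s, β s s = 1 := hβ.trace_eq_one
    rw [← Fintype.sum_mul_sum, h, hβ1, hα.trace_eq_one, Finset.prod_const_one, one_mul]

end Positions

/-! ### The received state -/

section Receiver

/-- The state of the receiver after both senders have prepared position states for their messages
`m₁`, `m₂` and sent their registers through the channel. -/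
def receivedState {A B C D F D' F' : Type*} {ι κ : Type*} [Fintype ι] [Fintype κ] [DecidableEq ι]
    [DecidableEq κ]
    (N : Matrix (A × B) (A × B) ℂ →ₗ[ℂ] Matrix C C ℂ)
    (φ₁ : Matrix (A × D × F) (A × D × F) ℂ) (α₁ : Matrix D D ℂ)
    (φ₂ : Matrix (B × D' × F') (B × D' × F') ℂ) (α₂ : Matrix D' D' ℂ) (m₁ : ι) (m₂ : κ) :
    Matrix (C × (((ι → D) × F) × ((κ → D') × F'))) (C × (((ι → D) × F) × ((κ → D') × F'))) ℂ :=
  applyLeft N ((positionState φ₁ α₁ m₁ ⊗ₖ positionState φ₂ α₂ m₂).submatrix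
    (Equiv.prodProdProdComm A B _ _) (Equiv.prodProdProdComm A B _ _))

/-- Splits the registers of the receiver into the first sender's position `j` with `C F F'`, where
the test for that position acts, and all other positions of both senders. -/
def splitPosition₁ (C D F D' F' : Type*) {ι : Type*} (κ : Type*) [DecidableEq ι] (j : ι) :
    ((C × F × F') × D) × (({i // i ≠ j} → D) × (κ → D')) ≃
      C × (((ι → D) × F) × ((κ → D') × F')) where
  toFun p := (p.1.1.1, (((Equiv.funSplitAt j D).symm (p.1.2, p.2.1), p.1.1.2.1),
    (p.2.2, p.1.1.2.2)))
  invFun q := (((q.1, q.2.1.2, q.2.2.2), (Equiv.funSplitAt j D q.2.1.1).1),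
    ((Equiv.funSplitAt j D q.2.1.1).2, q.2.2.1))
  left_inv p := by simp only [Equiv.apply_symm_apply]
  right_inv q := by simp only [Prod.mk.eta, Equiv.symm_apply_apply]

/-- The same as `splitPosition₁`, for the positions of the second sender. -/
def splitPosition₂ (C D F D' F' : Type*) (ι : Type*) {κ : Type*} [DecidableEq κ] (j : κ) :
    ((C × F × F') × D') × (({i // i ≠ j} → D') × (ι → D)) ≃
      C × (((ι → D) × F) × ((κ → D') × F')) where
  toFun p := (p.1.1.1, ((p.2.2, p.1.1.2.1),
    ((Equiv.funSplitAt j D').symm (p.1.2, p.2.1), p.1.1.2.2)))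
  invFun q := (((q.1, q.2.1.2, q.2.2.2), (Equiv.funSplitAt j D' q.2.2.1).1),
    ((Equiv.funSplitAt j D' q.2.2.1).2, q.2.1.1))
  left_inv p := by simp only [Equiv.apply_symm_apply]
  right_inv q := by simp only [Prod.mk.eta, Equiv.symm_apply_apply]

variable {A B C D F D' F' : Type u} {ι κ : Type*} [Fintype ι] [Fintype κ] [DecidableEq ι]
    [DecidableEq κ] [Fintype D] [Fintype D']
    (N : Matrix (A × B) (A × B) ℂ →ₗ[ℂ] Matrix C C ℂ)
    (φ₁ : Matrix (A × D × F) (A × D × F) ℂ) {α₁ : Matrix D D ℂ}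
    (φ₂ : Matrix (B × D' × F') (B × D' × F') ℂ) {α₂ : Matrix D' D' ℂ}

/-- The state on which the test for position `j` of the first sender acts. The case distinction is
between the position that holds the message and the others; `m₂` does not enter. -/
theorem marginal_receivedState₁ (hα₁ : α₁.trace = 1) (hα₂ : α₂.trace = 1) (m₁ j : ι) (m₂ : κ) :
    marginal (fun p k => splitPosition₁ C D F D' F' κ j (p, k))
      (receivedState N φ₁ α₁ φ₂ α₂ m₁ m₂) =
    Matrix.of fun ((c, s, t), v) ((c', s', t'), v') =>
      N (Matrix.of fun p q =>
        (if j = m₁ then φ₁ (p.1, v, s) (q.1, v', s') else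
          α₁ v v' * ∑ u, φ₁ (p.1, u, s) (q.1, u, s')) *
        ∑ u, φ₂ (p.2, u, t) (q.2, u, t')) c c' := by
  ext ⟨⟨c, s, t⟩, v⟩ ⟨⟨c', s', t'⟩, v'⟩
  refine (sum_applyLeft_apply N _ _ _ c c').trans ?_
  refine congrFun (congrFun (congrArg N (Matrix.ext fun p q => ?_)) c) c'
  rw [Matrix.of_apply, Matrix.of_apply, ← sum_positionState_split hα₁, ← sum_positionState hα₂ m₂,
    Fintype.sum_mul_sum, Fintype.sum_prod_type]
  rfl

theorem marginal_receivedState₂ (hα₁ : α₁.trace = 1) (hα₂ : α₂.trace = 1) (m₁ : ι) (m₂ j : κ) :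
    marginal (fun p k => splitPosition₂ C D F D' F' ι j (p, k))
      (receivedState N φ₁ α₁ φ₂ α₂ m₁ m₂) =
    Matrix.of fun ((c, s, t), v) ((c', s', t'), v') =>
      N (Matrix.of fun p q =>
        (∑ u, φ₁ (p.1, u, s) (q.1, u, s')) *
        (if j = m₂ then φ₂ (p.2, v, t) (q.2, v', t') else
          α₂ v v' * ∑ u, φ₂ (p.2, u, t) (q.2, u, t'))) c c' := by
  ext ⟨⟨c, s, t⟩, v⟩ ⟨⟨c', s', t'⟩, v'⟩
  refine (sum_applyLeft_apply N _ _ _ c c').trans ?_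
  refine congrFun (congrFun (congrArg N (Matrix.ext fun p q => ?_)) c) c'
  rw [Matrix.of_apply, Matrix.of_apply, ← sum_positionState_split hα₂, ← sum_positionState hα₁ m₁,
    Fintype.sum_mul_sum, Fintype.sum_prod_type, Finset.sum_comm]
  rfl

end Receiver

/-! ### Codes from a pair of measurements -/

section Code
open scoped MatrixOrder

/-- The receiver of a code may as well be given by a measurement with outcomes `(m₁, m₂)`. -/
theorem hasEntanglementAssistedCode_of_measurement {A B C EA EC₁ EB EC₂ : Type u} [Fintype A]
    [Fintype B] [Fintype C] [Fintype EA] [Fintype EC₁] [Fintype EB] [Fintype EC₂] [DecidableEq C]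
    [DecidableEq EC₁] [DecidableEq EC₂]
    {N : Matrix (A × B) (A × B) ℂ →ₗ[ℂ] Matrix C C ℂ} {R₁ R₂ e₁ e₂ : ℝ}
    {θ₁ : EA × EC₁ → ℂ} {θ₂ : EB × EC₂ → ℂ}
    {𝓔₁ : Matrix (Fin ⌊(2 : ℝ) ^ R₁⌋₊ × EA) (Fin ⌊(2 : ℝ) ^ R₁⌋₊ × EA) ℂ →ₗ[ℂ] Matrix A A ℂ}
    {𝓔₂ : Matrix (Fin ⌊(2 : ℝ) ^ R₂⌋₊ × EB) (Fin ⌊(2 : ℝ) ^ R₂⌋₊ × EB) ℂ →ₗ[ℂ] Matrix B B ℂ}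
    (hθ₁ : ∑ i, ‖θ₁ i‖ ^ 2 = 1) (hθ₂ : ∑ i, ‖θ₂ i‖ ^ 2 = 1)
    (h𝓔₁ : IsQuantumChannel 𝓔₁) (h𝓔₂ : IsQuantumChannel 𝓔₂)
    {E : Fin ⌊(2 : ℝ) ^ R₁⌋₊ × Fin ⌊(2 : ℝ) ^ R₂⌋₊ →
      Matrix (C × (EC₁ × EC₂)) (C × (EC₁ × EC₂)) ℂ}
    (hE : ∀ p, (E p).PosSemidef) (hE1 : ∑ p, E p = 1)
    (h : ∀ m₁ m₂, ∀ τ, τ = applyLeft N ((encodedState 𝓔₁ θ₁ m₁ ⊗ₖ encodedState 𝓔₂ θ₂ m₂).submatrix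
        (Equiv.prodProdProdComm A B EC₁ EC₂) (Equiv.prodProdProdComm A B EC₁ EC₂)) →
      ∑ p with p.1 ≠ m₁, (E p * τ).trace.re ≤ e₁ ∧ ∑ p with p.2 ≠ m₂, (E p * τ).trace.re ≤ e₂) :
    HasEntanglementAssistedCode N R₁ R₂ e₁ e₂ := by
  obtain ⟨𝓓, h𝓓, h𝓓E⟩ := exists_channel_of_measurement hE hE1
  refine ⟨EA, EC₁, EB, EC₂, inferInstance, inferInstance, inferInstance, inferInstance, θ₁, θ₂,
    𝓔₁, 𝓔₂, 𝓓, hθ₁, hθ₂, h𝓔₁, h𝓔₂, h𝓓, fun m₁ m₂ => ?_⟩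
  simp only [decodedState, h𝓓E]
  exact h m₁ m₂ _ rfl

/-- Measurements that each identify one sender's message with errors `e₁` and `e₂` give two codes,
according to which message is decoded first. -/
theorem hasEntanglementAssistedCode_of_measurements {A B C EC₁ EC₂ : Type u} [Fintype A]
    [Fintype B] [Fintype C] [Fintype EC₁] [Fintype EC₂] [DecidableEq C]
    [DecidableEq EC₁] [DecidableEq EC₂]
    {N : Matrix (A × B) (A × B) ℂ →ₗ[ℂ] Matrix C C ℂ} (hN : IsQuantumChannel N) {R₁ R₂ e₁ e₂ : ℝ}
    {ω₁ : Matrix EC₁ EC₁ ℂ} (hω₁ : IsState ω₁) {ω₂ : Matrix EC₂ EC₂ ℂ} (hω₂ : IsState ω₂)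
    {Φ₁ : Fin ⌊(2 : ℝ) ^ R₁⌋₊ → Matrix (A × EC₁) (A × EC₁) ℂ}
    {Φ₂ : Fin ⌊(2 : ℝ) ^ R₂⌋₊ → Matrix (B × EC₂) (B × EC₂) ℂ}
    (hΦ₁ : ∀ m, (Φ₁ m).PosSemidef) (hΦ₂ : ∀ m, (Φ₂ m).PosSemidef)
    (hΦω₁ : ∀ m, marginal (fun c a => (a, c)) (Φ₁ m) = ω₁)
    (hΦω₂ : ∀ m, marginal (fun c a => (a, c)) (Φ₂ m) = ω₂)
    {Ω : Fin ⌊(2 : ℝ) ^ R₁⌋₊ → Matrix (C × (EC₁ × EC₂)) (C × (EC₁ × EC₂)) ℂ}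
    {Ξ : Fin ⌊(2 : ℝ) ^ R₂⌋₊ → Matrix (C × (EC₁ × EC₂)) (C × (EC₁ × EC₂)) ℂ}
    (hΩ : ∀ i, 0 ≤ Ω i) (hΩs : ∑ i, Ω i = 1) (hΞ : ∀ j, 0 ≤ Ξ j) (hΞs : ∑ j, Ξ j = 1)
    (h : ∀ m₁ m₂, ∀ τ, τ = applyLeft N ((Φ₁ m₁ ⊗ₖ Φ₂ m₂).submatrix
        (Equiv.prodProdProdComm A B EC₁ EC₂) (Equiv.prodProdProdComm A B EC₁ EC₂)) → IsState τ →
      ((1 - Ω m₁) * τ).trace.re ≤ e₁ ∧ ((1 - Ξ m₂) * τ).trace.re ≤ e₂) :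
    HasEntanglementAssistedCode N R₁ R₂ e₁ (e₂ + 3 * √e₁) ∧
      HasEntanglementAssistedCode N R₁ R₂ (e₁ + 3 * √e₂) e₂ := by
  have hΦs₁ (m) : IsState (Φ₁ m) := ⟨hΦ₁ m, by
    rw [← hω₁.trace_eq_one, ← hΦω₁ m]
    simp only [Matrix.trace, Matrix.diag, marginal, Matrix.of_apply, Fintype.sum_prod_type_right]⟩
  have hΦs₂ (m) : IsState (Φ₂ m) := ⟨hΦ₂ m, by
    rw [← hω₂.trace_eq_one, ← hΦω₂ m]
    simp only [Matrix.trace, Matrix.diag, marginal, Matrix.of_apply, Fintype.sum_prod_type_right]⟩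
  obtain ⟨EA, _, θ₁, 𝓔₁, hθ₁, h𝓔₁, he₁⟩ := exists_encoder hω₁ hΦ₁ hΦω₁
  obtain ⟨EB, _, θ₂, 𝓔₂, hθ₂, h𝓔₂, he₂⟩ := exists_encoder hω₂ hΦ₂ hΦω₂
  have hτ (m₁ m₂) : IsState (applyLeft N ((Φ₁ m₁ ⊗ₖ Φ₂ m₂).submatrix
      (Equiv.prodProdProdComm A B EC₁ EC₂) (Equiv.prodProdProdComm A B EC₁ EC₂))) :=
    hN.isState_applyLeft (((hΦs₁ m₁).kronecker (hΦs₂ m₂)).submatrix_equiv _)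
  constructor
  · obtain ⟨E, hE, hE1, hEe⟩ := exists_sequential_measurement hΩ hΩs hΞ hΞs
    refine hasEntanglementAssistedCode_of_measurement hθ₁ hθ₂ h𝓔₁ h𝓔₂ hE hE1 fun m₁ m₂ τ hτe => ?_
    rw [he₁, he₂] at hτe
    have hs : IsState τ := hτe ▸ hτ m₁ m₂
    exact hEe τ m₁ m₂ e₁ e₂ hs (h m₁ m₂ τ hτe hs).1 (h m₁ m₂ τ hτe hs).2
  · obtain ⟨E, hE, hE1, hEe⟩ := exists_sequential_measurement hΞ hΞs hΩ hΩs
    refine hasEntanglementAssistedCode_of_measurement (E := fun p => E p.swap) hθ₁ hθ₂ h𝓔₁ h𝓔₂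
      (fun p => hE _) ?_ fun m₁ m₂ τ hτe => ?_
    · rw [← hE1]
      exact Equiv.sum_comp (Equiv.prodComm _ _) E
    rw [he₁, he₂] at hτe
    have hs : IsState τ := hτe ▸ hτ m₁ m₂
    have hb := hEe τ m₂ m₁ e₂ e₁ hs (h m₁ m₂ τ hτe hs).2 (h m₁ m₂ τ hτe hs).1
    simp only [Finset.sum_filter] at hb ⊢
    constructor
    · refine le_of_eq_of_le ?_ hb.2
      exact Equiv.sum_comp (Equiv.prodComm _ _)
        fun p => if p.2 ≠ m₁ then (E p * τ).trace.re else 0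
    · refine le_of_eq_of_le ?_ hb.1
      exact Equiv.sum_comp (Equiv.prodComm _ _)
        fun p => if p.1 ≠ m₂ then (E p * τ).trace.re else 0

end Code

/-! ### The input state -/

section InputMarginals
variable {A B A' B' A'' B'' : Type u} [Fintype A] [Fintype B] [Fintype A']
  [Fintype B'] [Fintype A''] [Fintype B'']
  {ψ : Matrix ((A × B) × (A' × B' × A'' × B'')) ((A × B) × (A' × B' × A'' × B'')) ℂ}

theorem IsSenderProduct.apply (hψ : IsSenderProduct ψ) (a a₂ : A) (b b₂ : B) (v v₂ : A')
    (w w₂ : B') (s s₂ : A'') (t t₂ : B'') :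
    ψ ((a, b), (v, w, s, t)) ((a₂, b₂), (v₂, w₂, s₂, t₂)) =
      marginal (fun (a, a', a'') (b, b', b'') => ((a, b), (a', b', a'', b''))) ψ
        (a, v, s) (a₂, v₂, s₂) *
      marginal (fun (b, b', b'') (a, a', a'') => ((a, b), (a', b', a'', b''))) ψ
        (b, w, t) (b₂, w₂, t₂) :=
  congrFun (congrFun hψ ((a, v, s), (b, w, t))) ((a₂, v₂, s₂), (b₂, w₂, t₂))

theorem IsReferenceProduct.apply (hψ : IsReferenceProduct ψ) (v v₂ : A')
    (w w₂ : B') (s s₂ : A'') (t t₂ : B'') :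
    ∑ p : A × B, ψ (p, (v, w, s, t)) (p, (v₂, w₂, s₂, t₂)) =
      marginal (fun a' (a, b, a'', b', b'') => ((a, b), (a', b', a'', b''))) ψ v v₂ *
      marginal (fun a'' (a, b, a', b', b'') => ((a, b), (a', b', a'', b''))) ψ s s₂ *
      marginal (fun b' (a, b, a', a'', b'') => ((a, b), (a', b', a'', b''))) ψ w w₂ *
      marginal (fun b'' (a, b, a', a'', b') => ((a, b), (a', b', a'', b''))) ψ t t₂ :=
  congrFun (congrFun hψ (((v, s), w), t)) (((v₂, s₂), w₂), t₂)

theorem isState_marginal_A' (hψ : IsState ψ) :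
    IsState (marginal (fun a' (a, b, a'', b', b'') => ((a, b), (a', b', a'', b''))) ψ) :=
  hψ.marginal ⟨by rintro ⟨a', a, b, a'', b', b''⟩ ⟨a', a, b, a'', b', b''⟩ h; simp_all,
    fun ((a, b), (a', b', a'', b'')) => ⟨(a', a, b, a'', b', b''), rfl⟩⟩

theorem isState_marginal_A'' (hψ : IsState ψ) :
    IsState (marginal (fun a'' (a, b, a', b', b'') => ((a, b), (a', b', a'', b''))) ψ) :=
  hψ.marginal ⟨by rintro ⟨a'', a, b, a', b', b''⟩ ⟨a'', a, b, a', b', b''⟩ h; simp_all,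
    fun ((a, b), (a', b', a'', b'')) => ⟨(a'', a, b, a', b', b''), rfl⟩⟩

theorem isState_marginal_B' (hψ : IsState ψ) :
    IsState (marginal (fun b' (a, b, a', a'', b'') => ((a, b), (a', b', a'', b''))) ψ) :=
  hψ.marginal ⟨by rintro ⟨b', a, b, a', a'', b''⟩ ⟨b', a, b, a', a'', b''⟩ h; simp_all,
    fun ((a, b), (a', b', a'', b'')) => ⟨(b', a, b, a', a'', b''), rfl⟩⟩

theorem isState_marginal_B'' (hψ : IsState ψ) :
    IsState (marginal (fun b'' (a, b, a', a'', b') => ((a, b), (a', b', a'', b''))) ψ) :=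
  hψ.marginal ⟨by rintro ⟨b'', a, b, a', a'', b'⟩ ⟨b'', a, b, a', a'', b'⟩ h; simp_all,
    fun ((a, b), (a', b', a'', b'')) => ⟨(b'', a, b, a', a'', b'), rfl⟩⟩

/-- `ψ_{A'A''} = ψ_{A'} ⊗ ψ_{A''}`, read off from the four-fold product by tracing out `B'B''`. -/
theorem sum_senderMarginal_A (hψ : IsState ψ) (hψ₂ : IsReferenceProduct ψ) (v v' : A')
    (s s' : A'') :
    ∑ a, marginal (fun (a, a', a'') (b, b', b'') => ((a, b), (a', b', a'', b''))) ψ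
        (a, v, s) (a, v', s') =
      marginal (fun a' (a, b, a'', b', b'') => ((a, b), (a', b', a'', b''))) ψ v v' *
      marginal (fun a'' (a, b, a', b', b'') => ((a, b), (a', b', a'', b''))) ψ s s' := by
  have h1 : ∑ w, _ = (1 : ℂ) := (isState_marginal_B' hψ).trace_eq_one
  have h2 : ∑ t, _ = (1 : ℂ) := (isState_marginal_B'' hψ).trace_eq_one
  have h : ∑ w, ∑ t, ∑ p : A × B, ψ (p, (v, w, s, t)) (p, (v', w, s', t)) = _ :=
    Finset.sum_congr rfl fun w _ => Finset.sum_congr rfl fun t _ => hψ₂.apply v v' w w s s' t t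
  simp_rw [← Finset.mul_sum] at h
  simp only [Matrix.diag] at h1 h2
  rw [h2] at h
  simp_rw [mul_one] at h
  rw [← Finset.mul_sum, h1, mul_one] at h
  rw [← h]
  simp only [marginal, Matrix.of_apply, Fintype.sum_prod_type]
  rw [Finset.sum_congr rfl fun a _ => Finset.sum_comm, Finset.sum_comm]
  refine Finset.sum_congr rfl fun w _ => ?_
  rw [Finset.sum_congr rfl fun a _ => Finset.sum_comm, Finset.sum_comm]

theorem sum_senderMarginal_B (hψ : IsState ψ) (hψ₂ : IsReferenceProduct ψ) (w w' : B')
    (t t' : B'') :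
    ∑ b, marginal (fun (b, b', b'') (a, a', a'') => ((a, b), (a', b', a'', b''))) ψ
        (b, w, t) (b, w', t') =
      marginal (fun b' (a, b, a', a'', b'') => ((a, b), (a', b', a'', b''))) ψ w w' *
      marginal (fun b'' (a, b, a', a'', b') => ((a, b), (a', b', a'', b''))) ψ t t' := by
  have h1 : ∑ v, _ = (1 : ℂ) := (isState_marginal_A' hψ).trace_eq_one
  have h2 : ∑ s, _ = (1 : ℂ) := (isState_marginal_A'' hψ).trace_eq_one
  have h : ∑ v, ∑ s, ∑ p : A × B, ψ (p, (v, w, s, t)) (p, (v, w', s, t')) = _ :=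
    Finset.sum_congr rfl fun v _ => Finset.sum_congr rfl fun s _ => hψ₂.apply v v w w' s s t t'
  simp only [Matrix.diag] at h1 h2
  simp_rw [← Finset.sum_mul, ← Finset.mul_sum] at h
  rw [h2] at h
  simp_rw [mul_one] at h
  rw [h1, one_mul] at h
  rw [← h]
  simp only [marginal, Matrix.of_apply, Fintype.sum_prod_type]
  rw [Finset.sum_comm, Finset.sum_congr rfl fun a _ => Finset.sum_comm, Finset.sum_comm]
  refine Finset.sum_congr rfl fun w _ => ?_
  rw [Finset.sum_congr rfl fun a _ => Finset.sum_comm, Finset.sum_comm]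

end InputMarginals

/-! ### Marginals of the channel output -/

section Output
variable {A B C A' B' A'' B'' : Type u}
  {ψ : Matrix ((A × B) × (A' × B' × A'' × B'')) ((A × B) × (A' × B' × A'' × B'')) ℂ}

variable (N : Matrix (A × B) (A × B) ℂ →ₗ[ℂ] Matrix C C ℂ)
  {φ₁ : Matrix (A × A' × A'') (A × A' × A'') ℂ} {φ₂ : Matrix (B × B' × B'') (B × B' × B'') ℂ}

theorem marginal_applyLeft_CA'' [Fintype A'] [Fintype B'] (hψ : ∀ a a₂ b b₂ v v₂ w w₂ s s₂ t t₂,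
      ψ ((a, b), (v, w, s, t)) ((a₂, b₂), (v₂, w₂, s₂, t₂)) =
        φ₁ (a, v, s) (a₂, v₂, s₂) * φ₂ (b, w, t) (b₂, w₂, t₂)) :
    marginal (fun (c, a'', b'') (a', b') => (c, (a', b', a'', b''))) (applyLeft N ψ) =
      Matrix.of fun (c, s, t) (c', s', t') =>
        N (Matrix.of fun p q => (∑ u, φ₁ (p.1, u, s) (q.1, u, s')) *
          ∑ u, φ₂ (p.2, u, t) (q.2, u, t')) c c' := by
  ext ⟨c, s, t⟩ ⟨c', s', t'⟩
  refine (sum_applyLeft_apply N _ _ _ c c').trans ?_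
  refine congrFun (congrFun (congrArg N (Matrix.ext fun p q => ?_)) c) c'
  rw [Matrix.of_apply, Matrix.of_apply, Fintype.sum_mul_sum, Fintype.sum_prod_type]
  exact Finset.sum_congr rfl fun _ _ => Finset.sum_congr rfl fun _ _ => hψ _ _ _ _ _ _ _ _ _ _ _ _

theorem marginal_applyLeft_A'CA'' [Fintype B'] (hψ : ∀ a a₂ b b₂ v v₂ w w₂ s s₂ t t₂,
      ψ ((a, b), (v, w, s, t)) ((a₂, b₂), (v₂, w₂, s₂, t₂)) =
        φ₁ (a, v, s) (a₂, v₂, s₂) * φ₂ (b, w, t) (b₂, w₂, t₂)) :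
    marginal (fun ((c, a'', b''), a') b' => (c, (a', b', a'', b''))) (applyLeft N ψ) =
      Matrix.of fun ((c, s, t), v) ((c', s', t'), v') =>
        N (Matrix.of fun p q => φ₁ (p.1, v, s) (q.1, v', s') *
          ∑ u, φ₂ (p.2, u, t) (q.2, u, t')) c c' := by
  ext ⟨⟨c, s, t⟩, v⟩ ⟨⟨c', s', t'⟩, v'⟩
  refine (sum_applyLeft_apply N _ _ _ c c').trans ?_
  refine congrFun (congrFun (congrArg N (Matrix.ext fun p q => ?_)) c) c'
  rw [Matrix.of_apply, Matrix.of_apply, Finset.mul_sum]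
  exact Finset.sum_congr rfl fun _ _ => hψ _ _ _ _ _ _ _ _ _ _ _ _

theorem marginal_applyLeft_B'CA'' [Fintype A'] (hψ : ∀ a a₂ b b₂ v v₂ w w₂ s s₂ t t₂,
      ψ ((a, b), (v, w, s, t)) ((a₂, b₂), (v₂, w₂, s₂, t₂)) =
        φ₁ (a, v, s) (a₂, v₂, s₂) * φ₂ (b, w, t) (b₂, w₂, t₂)) :
    marginal (fun ((c, a'', b''), b') a' => (c, (a', b', a'', b''))) (applyLeft N ψ) =
      Matrix.of fun ((c, s, t), w) ((c', s', t'), w') =>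
        N (Matrix.of fun p q => (∑ u, φ₁ (p.1, u, s) (q.1, u, s')) *
          φ₂ (p.2, w, t) (q.2, w', t')) c c' := by
  ext ⟨⟨c, s, t⟩, w⟩ ⟨⟨c', s', t'⟩, w'⟩
  refine (sum_applyLeft_apply N _ _ _ c c').trans ?_
  refine congrFun (congrFun (congrArg N (Matrix.ext fun p q => ?_)) c) c'
  rw [Matrix.of_apply, Matrix.of_apply, Finset.sum_mul]
  exact Finset.sum_congr rfl fun _ _ => hψ _ _ _ _ _ _ _ _ _ _ _ _

variable {N} [Fintype A] [Fintype B] [Fintype C] [Fintype A''] [Fintype B'']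

theorem marginal_applyLeft_A' [Fintype B'] (hN : IsQuantumChannel N) :
    marginal (fun a' (c, b', a'', b'') => (c, (a', b', a'', b''))) (applyLeft N ψ) =
      marginal (fun a' (a, b, a'', b', b'') => ((a, b), (a', b', a'', b''))) ψ := by
  ext v v'
  have h (k : B' × A'' × B'') : ∑ c, applyLeft N ψ (c, (v, k)) (c, (v', k)) =
      ∑ p, ψ (p, (v, k)) (p, (v', k)) :=
    hN.tracePreserving (Matrix.of fun p q => ψ (p, (v, k)) (q, (v', k)))
  simp only [marginal, Matrix.of_apply]
  rw [Fintype.sum_prod_type_right]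
  refine (Finset.sum_congr rfl fun k _ => h k).trans ?_
  rw [Finset.sum_comm]
  simp only [Fintype.sum_prod_type]
  exact Finset.sum_congr rfl fun _ _ => Finset.sum_congr rfl fun _ _ => Finset.sum_comm

theorem marginal_applyLeft_B' [Fintype A'] (hN : IsQuantumChannel N) :
    marginal (fun b' (c, a', a'', b'') => (c, (a', b', a'', b''))) (applyLeft N ψ) =
      marginal (fun b' (a, b, a', a'', b'') => ((a, b), (a', b', a'', b''))) ψ := by
  ext w w'
  have h (k : A' × A'' × B'') :
      ∑ c, applyLeft N ψ (c, (k.1, w, k.2)) (c, (k.1, w', k.2)) =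
      ∑ p, ψ (p, (k.1, w, k.2)) (p, (k.1, w', k.2)) :=
    hN.tracePreserving (Matrix.of fun p q => ψ (p, (k.1, w, k.2)) (q, (k.1, w', k.2)))
  simp only [marginal, Matrix.of_apply]
  rw [Fintype.sum_prod_type_right]
  refine (Finset.sum_congr rfl fun k _ => h k).trans ?_
  rw [Finset.sum_comm]
  simp only [Fintype.sum_prod_type]

end Output

theorem theorem9 {A B C A' B' A'' B'' : Type u}
    [Fintype A] [Fintype B] [Fintype C] [Fintype A'] [Fintype B'] [Fintype A''] [Fintype B'']
    [DecidableEq C] [DecidableEq A'] [DecidableEq B'] [DecidableEq A''] [DecidableEq B'']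
    (N : Matrix (A × B) (A × B) ℂ →ₗ[ℂ] Matrix C C ℂ) (hN : IsQuantumChannel N)
    (ε₁ ε₂ δ : ℝ) (hε₁ : ε₁ ∈ Set.Ioo (0 : ℝ) 1) (hε₂ : ε₂ ∈ Set.Ioo (0 : ℝ) 1)
    (hδ : δ ∈ Set.Ioo (0 : ℝ) 1) (hδ₁ : δ ≤ ε₁) (hδ₂ : δ ≤ ε₂)
    (ψ : Matrix ((A × B) × (A' × B' × A'' × B'')) ((A × B) × (A' × B' × A'' × B'')) ℂ)
    (hψ : IsState ψ) (hψ₁ : IsSenderProduct ψ) (hψ₂ : IsReferenceProduct ψ)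
    (R₁ R₂ : ℝ) (hR₁ : 0 ≤ R₁) (hR₂ : 0 ≤ R₂)
    (hrate₁ : (R₁ : EReal) ≤ rateBound₁ ε₁ (applyLeft N ψ) -
      ((Real.logb 2 (4 * ε₁ / δ ^ 2) : ℝ) : EReal))
    (hrate₂ : (R₂ : EReal) ≤ rateBound₂ ε₂ (applyLeft N ψ) -
      ((Real.logb 2 (4 * ε₂ / δ ^ 2) : ℝ) : EReal)) :
    HasEntanglementAssistedCode N R₁ R₂
        (ε₁ + 2 * δ) (ε₂ + 2 * δ + 3 * Real.sqrt (ε₁ + 2 * δ)) ∧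
    HasEntanglementAssistedCode N R₁ R₂
        (ε₁ + 2 * δ + 3 * Real.sqrt (ε₂ + 2 * δ)) (ε₂ + 2 * δ) := by
  set φ₁ := marginal (fun (a, a', a'') (b, b', b'') => ((a, b), (a', b', a'', b''))) ψ with hφ₁
  set φ₂ := marginal (fun (b, b', b'') (a, a', a'') => ((a, b), (a', b', a'', b''))) ψ with hφ₂
  set α₁ := marginal (fun a' (a, b, a'', b', b'') => ((a, b), (a', b', a'', b''))) ψ with hα₁
  set α₂ := marginal (fun b' (a, b, a', a'', b'') => ((a, b), (a', b', a'', b''))) ψ with hα₂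
  have sα₁ : IsState α₁ := isState_marginal_A' hψ
  have sα₂ : IsState α₂ := isState_marginal_B' hψ
  have sβ₁ := isState_marginal_A'' hψ
  have sβ₂ := isState_marginal_B'' hψ
  have hψe := hψ₁.apply
  rw [← hφ₁, ← hφ₂] at hψe
  have sρ : IsState (applyLeft N ψ) := hN.isState_applyLeft hψ
  have sρ₀ : IsState (marginal (fun (c, a'', b'') (a', b') => (c, (a', b', a'', b'')))
      (applyLeft N ψ)) :=
    sρ.marginal ⟨by rintro ⟨⟨c, a'', b''⟩, a', b'⟩ ⟨⟨c, a'', b''⟩, a', b'⟩ h; simp_all,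
      fun (c, (a', b', a'', b'')) => ⟨((c, a'', b''), a', b'), rfl⟩⟩
  have sρ₁ : IsState (marginal (fun ((c, a'', b''), a') b' => (c, (a', b', a'', b'')))
      (applyLeft N ψ)) :=
    sρ.marginal ⟨by rintro ⟨⟨⟨c, a'', b''⟩, a'⟩, b'⟩ ⟨⟨⟨c, a'', b''⟩, a'⟩, b'⟩ h; simp_all,
      fun (c, (a', b', a'', b'')) => ⟨(((c, a'', b''), a'), b'), rfl⟩⟩
  have sρ₂ : IsState (marginal (fun ((c, a'', b''), b') a' => (c, (a', b', a'', b'')))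
      (applyLeft N ψ)) :=
    sρ.marginal ⟨by rintro ⟨⟨⟨c, a'', b''⟩, b'⟩, a'⟩ ⟨⟨⟨c, a'', b''⟩, b'⟩, a'⟩ h; simp_all,
      fun (c, (a', b', a'', b'')) => ⟨(((c, a'', b''), b'), a'), rfl⟩⟩
  unfold rateBound₁ at hrate₁
  unfold rateBound₂ at hrate₂
  rw [marginal_applyLeft_A' hN] at hrate₁
  rw [marginal_applyLeft_B' hN] at hrate₂
  obtain ⟨Λ₁, t₁, hΛ₁, hΛ₁le, hΛ₁ρ, hΛ₁σ, ht₁⟩ := exists_posDef_test sρ₁ (sρ₀.kronecker sα₁)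
    hε₁.1 hδ.1 hR₁ hrate₁
  obtain ⟨Λ₂, t₂, hΛ₂, hΛ₂le, hΛ₂ρ, hΛ₂σ, ht₂⟩ := exists_posDef_test sρ₂ (sρ₀.kronecker sα₂)
    hε₂.1 hδ.1 hR₂ hrate₂
  set K₁ := ⌊(2 : ℝ) ^ R₁⌋₊ with hK₁
  set K₂ := ⌊(2 : ℝ) ^ R₂⌋₊ with hK₂
  have : NeZero K₁ := ⟨(Nat.floor_pos.mpr (Real.one_le_rpow one_le_two hR₁)).ne'⟩
  have : NeZero K₂ := ⟨(Nat.floor_pos.mpr (Real.one_le_rpow one_le_two hR₂)).ne'⟩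
  obtain ⟨Ω, hΩ, hΩs, hΩe⟩ := exists_measurement_of_tests
    (Λ := fun j : Fin K₁ => liftTest (splitPosition₁ C A' A'' B' B'' (Fin K₂) j) Λ₁)
    (fun j => posDef_liftTest _ hΛ₁) (fun j => liftTest_le_one _ hΛ₁le) hδ.1 hδ₁
    (by rwa [Fintype.card_fin])
  obtain ⟨Ξ, hΞ, hΞs, hΞe⟩ := exists_measurement_of_tests
    (Λ := fun j : Fin K₂ => liftTest (splitPosition₂ C A' A'' B' B'' (Fin K₁) j) Λ₂)
    (fun j => posDef_liftTest _ hΛ₂) (fun j => liftTest_le_one _ hΛ₂le) hδ.1 hδ₂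
    (by rwa [Fintype.card_fin])
  have hρ₁ := marginal_applyLeft_A'CA'' N hψe
  have hρ₂ := marginal_applyLeft_B'CA'' N hψe
  have hρ₀ := marginal_applyLeft_CA'' N hψe
  refine hasEntanglementAssistedCode_of_measurements hN
    (isState_positionMarginal sα₁ sβ₁) (isState_positionMarginal sα₂ sβ₂)
    (fun m => posSemidef_positionState hψ.posSemidef.marginal sα₁.posSemidef m)
    (fun m => posSemidef_positionState hψ.posSemidef.marginal sα₂.posSemidef m)
    (fun m => marginal_positionState (sum_senderMarginal_A hψ hψ₂) m)
    (fun m => marginal_positionState (sum_senderMarginal_B hψ hψ₂) m)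
    hΩ hΩs hΞ hΞs fun m₁ m₂ τ hτ sτ => ⟨?_, ?_⟩
  · have hm (j : Fin K₁) :=
      marginal_receivedState₁ N φ₁ φ₂ sα₁.trace_eq_one sα₂.trace_eq_one m₁ j m₂
    change τ = receivedState N φ₁ α₁ φ₂ α₂ m₁ m₂ at hτ
    rw [← hτ] at hm
    -- the position of the message carries `ρ_{A'CA''B''}`, whatever `m₂` is
    refine hΩe τ m₁ sτ.posSemidef sτ.trace_eq_one ?_ fun j hj => ?_
    · rw [trace_liftTest_mul, hm]
      simp only [if_true]
      rwa [← hρ₁]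
    · rw [trace_liftTest_mul, hm]
      simp only [if_neg hj]
      -- a wrong position carries `ρ_{CA''B''} ⊗ ψ_{A'}`: the scalar entry of `ψ_{A'}` leaves `N`
      convert hΛ₁σ using 4
      rw [hρ₀]
      ext ⟨⟨c, s, t⟩, v⟩ ⟨⟨c', s', t'⟩, v'⟩
      simp only [Matrix.of_apply, Matrix.kroneckerMap_apply]
      rw [mul_comm _ (α₁ v v'), ← smul_eq_mul (α₁ v v'), ← Matrix.smul_apply, ← map_smul]
      refine congrFun (congrFun (congrArg N (Matrix.ext fun p q => ?_)) c) c'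
      simp [mul_assoc]
  · have hm (j : Fin K₂) :=
      marginal_receivedState₂ N φ₁ φ₂ sα₁.trace_eq_one sα₂.trace_eq_one m₁ m₂ j
    change τ = receivedState N φ₁ α₁ φ₂ α₂ m₁ m₂ at hτ
    rw [← hτ] at hm
    refine hΞe τ m₂ sτ.posSemidef sτ.trace_eq_one ?_ fun j hj => ?_
    · rw [trace_liftTest_mul, hm]
      simp only [if_true]
      rwa [← hρ₂]
    · rw [trace_liftTest_mul, hm]
      simp only [if_neg hj]
      -- a wrong position carries `ρ_{CA''B''} ⊗ ψ_{B'}`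
      convert hΛ₂σ using 4
      rw [hρ₀]
      ext ⟨⟨c, s, t⟩, w⟩ ⟨⟨c', s', t'⟩, w'⟩
      simp only [Matrix.of_apply, Matrix.kroneckerMap_apply]
      rw [mul_comm _ (α₂ w w'), ← smul_eq_mul (α₂ w w'), ← Matrix.smul_apply, ← map_smul]
      refine congrFun (congrFun (congrArg N (Matrix.ext fun p q => ?_)) c) c'
      simp [mul_left_comm]
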